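/- Let $\mathbb F$ be a field of characteristic $2$. A symplectic alternating algebra (SAA) over $\mathbb F$ is a vector space $L$ with a non-degenerate alternating form $(\cdot,\cdot)$ and an alternating bilinear product such that $(xy,z)=(yz,x)$ for all $x,y,z$; isomorphisms preserve form and product. Put $L^1=L$, $L^{n+1}=L^nL$ (span of products), $Z_0(L)=0$, $Z_{n+1}(L)=\{x: xL\subseteq Z_n(L)\}$ and $Z(L)=Z_1(L)$; $L$ is nilpotent if $L^n=0$ for some $n$. A standard basis of an SAA of dimension $10$ is a basis $x_1,y_1,\dots,x_5,y_5$ with $(x_i,x_j)=(y_i,y_j)=0$ and $(x_i,y_j)=\delta_{ij}$. For $\gamma,r,s\in\mathbb F$ let $\mathcal P_{10}^{(3,9)}(\gamma,r,s)$ be the presentation, with respect to a standard basis, $$(x_2y_4,y_5)=\gamma,\ (x_1y_3,y_4)=r,\ (x_1y_3,y_5)=s,\ (x_1y_2,y_4)=1,\ (y_1y_2,y_5)=1,\ (y_1y_3,y_4)=1,$$ where, on ordering the basis as $x_1,\dots,x_5,y_1,\dots,y_5$, the values $(uv,w)$ at all other triples of basis vectors $u<v<w$ are $0$. Put $H(r)=\{x^2+rx: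 x\in\mathbb F\}$ and $G(r,s)=\{x^2+rxy+sy^2: (x,y)\in\mathbb F^2\setminus\{(0,0)\}\}$. (1) Let $L$ be a nilpotent SAA of dimension $10$ over $\mathbb F$ such that $Z(L)$ is isotropic of dimension $3$, $\dim L^3=6$ and $L^3L^2=L^5$. Suppose that for some $y_2\in L^2\setminus L^3$ and $y_3\in Z_4(L)\setminus L^2$ the linear map $\tau=\psi\phi^{-1}:L^5\to L^5$, where $\phi,\psi:L^3/L^4\to L^5$ are induced by $u\mapsto uy_2$ and $u\mapsto uy_3$, has minimal polynomial $t^2+rt+s$ that is irreducible over $\mathbb F$ with $r\neq0$. Then $L$ has a presentation $\mathcal P_{10}^{(3,9)}(\gamma,r,s)$ for some $\gamma,r,s\in\mathbb F$ with $\gamma\ne0$, $r\neq 0$ and $t^2+rt+s$ irreducible over $\mathbb F$. (2) Let $\gamma,r,\tilde\gamma,\tilde r\in\mathbb F\setminus\{0\}$ and $s,\tilde s\in\mathbb F$ be such that $t^2+rt+s$ and $t^2+\tilde rt+\tilde s$ are irreducible over $\mathbb F$. The algebras given by $\mathcal P_{10}^{(3,9)}(\tilde\gamma,\tilde r,\tilde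 s)$ and $\mathcal P_{10}^{(3,9)}(\gamma,r,s)$ are isomorphic if and only if $$\frac{\tilde\gamma}{\gamma}\in(\mathbb F^*)^3,\qquad \frac{\tilde r}{r}\in G(r,s),\qquad \tilde s-\Big(\frac{\tilde r}{r}\Big)^2s\in H(\tilde r).$$ -/

import Mathlib

open Polynomial

/-- A symplectic alternating algebra structure on the `F`-space `L`: a non-degenerate alternating
form together with an alternating bilinear product such that `(x·y, z) = (y·z, x)`. -/
structure SAA (F L : Type*) [Field F] [AddCommGroup L] [Module F L] where
  form : LinearMap.BilinForm F L
  mul : L →ₗ[F] L →ₗ[F] L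
  form_alt : ∀ x, form x x = 0
  form_nondeg : form.Nondegenerate
  mul_alt : ∀ x, mul x x = 0
  cyclic : ∀ x y z, form (mul x y) z = form (mul y z) x

namespace SAA

section General

variable {F L L' : Type*} [Field F] [AddCommGroup L] [Module F L] [AddCommGroup L'] [Module F L']

/-- The product `U·V` of two subspaces: the span of all products `u·v`. -/
def prod (A : SAA F L) (U V : Submodule F L) : Submodule F L := Submodule.map₂ A.mul U V

/-- The lower central series, indexed as usual: `L¹ = L` and `Lⁿ⁺¹ = Lⁿ·L`
(with the convention `L⁰ = L`). -/
def pow (A : SAA F L) : ℕ → Submodule F L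
  | 0 => ⊤
  | 1 => ⊤
  | n + 2 => A.prod (A.pow (n + 1)) ⊤

/-- The upper central series: `Z₀ = 0` and `Zₙ₊₁ = {x : x·L ⊆ Zₙ}`. -/
def upper (A : SAA F L) : ℕ → Submodule F L
  | 0 => ⊥
  | n + 1 => ⨅ y : L, (A.upper n).comap (A.mul.flip y)

/-- The centre `Z(L) = {x : x·L = 0}`. -/
def center (A : SAA F L) : Submodule F L := LinearMap.ker A.mul

def IsNilpotent (A : SAA F L) : Prop := ∃ n, A.pow n = ⊥

/-- The form vanishes on the subspace `U`. -/
def IsIsotropic (A : SAA F L) (U : Submodule F L) : Prop :=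
  ∀ x ∈ U, ∀ y ∈ U, A.form x y = 0

/-- `τ = ψ ∘ φ⁻¹` on `L⁵`, where `φ(u) = u·y₂` and `ψ(u) = u·y₃` for `u ∈ L³`; that is,
`φ` maps `L³` into `L⁵` and `τ ∘ φ = ψ`. This determines `τ` when `L³·y₂ = L⁵`. -/
def IsTau (A : SAA F L) (y₂ y₃ : L) (τ : Module.End F (A.pow 5)) : Prop :=
  ∀ u ∈ A.pow 3, ∃ w : A.pow 5, (w : L) = A.mul u y₂ ∧ (τ w : L) = A.mul u y₃

/-- For `y₂` completing `L³` to `L²` and `y₃` completing `L²` to `Z₄(L)`, the minimal polynomial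
of the map `τ` attached to `y₂, y₃` is an irreducible quadratic `t² + r t + s` with `r ≠ 0`. -/
def IsTypeCWithLinearTerm (A : SAA F L) : Prop :=
  ∃ y₂ ∈ A.pow 2, y₂ ∉ A.pow 3 ∧ ∃ y₃ ∈ A.upper 4, y₃ ∉ A.pow 2 ∧
    ∃ τ : Module.End F (A.pow 5), A.IsTau y₂ y₃ τ ∧
      ∃ r s : F, r ≠ 0 ∧ minpoly F τ = X ^ 2 + C r * X + C s ∧
        Irreducible (X ^ 2 + C r * X + C s)

/-- A standard basis `x₁, …, xₙ, y₁, …, yₙ`: `(xᵢ, xⱼ) = (yᵢ, yⱼ) = 0` and `(xᵢ, yⱼ) = δᵢⱼ`.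
The vector `xᵢ₊₁` is `b (.inl i)` and `yᵢ₊₁` is `b (.inr i)`. -/
def IsStandardBasis (A : SAA F L) {n : ℕ} (b : Module.Basis (Fin n ⊕ Fin n) F L) : Prop :=
  (∀ i j, A.form (b (.inl i)) (b (.inl j)) = 0) ∧
  (∀ i j, A.form (b (.inr i)) (b (.inr j)) = 0) ∧
  (∀ i j, A.form (b (.inl i)) (b (.inr j)) = if i = j then 1 else 0)

/-- `A` is described by the triple values `p` with respect to some standard basis `u`, ordered
as `x₁ < … < xₙ < y₁ < … < yₙ`: `(uᵢ·uⱼ, uₖ) = p i j k` for all `i < j < k`. -/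
def HasPresentation (A : SAA F L) {n : ℕ}
    (p : Fin n ⊕ Fin n → Fin n ⊕ Fin n → Fin n ⊕ Fin n → F) : Prop :=
  ∃ b : Module.Basis (Fin n ⊕ Fin n) F L, A.IsStandardBasis b ∧
    ∀ i j k, toLex i < toLex j → toLex j < toLex k → A.form (A.mul (b i) (b j)) (b k) = p i j k

/-- Isomorphism of symplectic alternating algebras: a linear bijection that preserves the
form and the product. -/
def Isomorphic (A : SAA F L) (B : SAA F L') : Prop :=
  ∃ e : L ≃ₗ[F] L', (∀ x y, B.form (e x) (e y) = A.form x y) ∧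
    ∀ x y, e (A.mul x y) = B.mul (e x) (e y)

end General

section Presented

variable {F : Type*} [Field F] {n : ℕ}

/-- The standard symplectic form on the space with basis `x₁, …, xₙ, y₁, …, yₙ`. -/
def stdForm (F : Type*) [Field F] (n : ℕ) : LinearMap.BilinForm F (Fin n ⊕ Fin n → F) :=
  LinearMap.mk₂ F
    (fun a b => ∑ i, (a (.inl i) * b (.inr i) - a (.inr i) * b (.inl i)))
    (fun a a' b => by rw [← Finset.sum_add_distrib]; simp only [Pi.add_apply]; congr! 1; ring)
    (fun c a b => by
      rw [smul_eq_mul, Finset.mul_sum]; simp only [Pi.smul_apply, smul_eq_mul]; congr! 1; ring)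
    (fun a b b' => by rw [← Finset.sum_add_distrib]; simp only [Pi.add_apply]; congr! 1; ring)
    (fun c a b => by
      rw [smul_eq_mul, Finset.mul_sum]; simp only [Pi.smul_apply, smul_eq_mul]; congr! 1; ring)

/-- The `3 × 3` minor of the vectors `a, b, c` in the coordinates `i, j, k`. -/
def minor {ι : Type*} (i j k : ι) (a b c : ι → F) : F :=
  a i * (b j * c k - b k * c j) - a j * (b i * c k - b k * c i) + a k * (b i * c j - b j * c i)

/-- The alternating trilinear form with value `p i j k` on the basis vectors `i < j < k`. -/
def triple (p : Fin n ⊕ Fin n → Fin n ⊕ Fin n → Fin n ⊕ Fin n → F)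
    (a b c : Fin n ⊕ Fin n → F) : F :=
  ∑ i, ∑ j, ∑ k, if toLex i < toLex j ∧ toLex j < toLex k then p i j k * minor i j k a b c else 0

variable (p : Fin n ⊕ Fin n → Fin n ⊕ Fin n → Fin n ⊕ Fin n → F)

theorem triple_cyclic (a b c : Fin n ⊕ Fin n → F) : triple p a b c = triple p b c a := by
  unfold triple minor
  refine Finset.sum_congr rfl fun i _ => Finset.sum_congr rfl fun j _ =>
    Finset.sum_congr rfl fun k _ => ?_
  split_ifs
  · ring
  · rfl

theorem triple_self (a c : Fin n ⊕ Fin n → F) : triple p a a c = 0 := by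
  unfold triple minor
  refine Finset.sum_eq_zero fun i _ => Finset.sum_eq_zero fun j _ => Finset.sum_eq_zero fun k _ => ?_
  split_ifs
  · ring
  · rfl

theorem triple_add (a b c c' : Fin n ⊕ Fin n → F) :
    triple p a b (c + c') = triple p a b c + triple p a b c' := by
  unfold triple minor
  simp only [← Finset.sum_add_distrib]
  refine Finset.sum_congr rfl fun i _ => Finset.sum_congr rfl fun j _ =>
    Finset.sum_congr rfl fun k _ => ?_
  split_ifs
  · simp only [Pi.add_apply]; ring
  · simp

theorem triple_smul (t : F) (a b c : Fin n ⊕ Fin n → F) :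
    triple p a b (t • c) = t * triple p a b c := by
  unfold triple minor
  simp only [Finset.mul_sum]
  refine Finset.sum_congr rfl fun i _ => Finset.sum_congr rfl fun j _ =>
    Finset.sum_congr rfl fun k _ => ?_
  split_ifs
  · simp only [Pi.smul_apply, smul_eq_mul]; ring
  · simp

/-- The product determined by `(a·b, c) = triple p a b c`. -/
def presentedMul :
    (Fin n ⊕ Fin n → F) →ₗ[F] (Fin n ⊕ Fin n → F) →ₗ[F] (Fin n ⊕ Fin n → F) :=
  LinearMap.mk₂ F
    (fun a b => Sum.elim (fun i => triple p a b (Pi.single (.inr i) 1))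
      (fun i => - triple p a b (Pi.single (.inl i) 1)))
    (fun a a' b => by
      ext (i | i) <;> simp only [Sum.elim_inl, Sum.elim_inr, Pi.add_apply] <;>
        rw [triple_cyclic p (a + a') b, triple_add, ← triple_cyclic p a b, ← triple_cyclic p a' b]
      ring)
    (fun t a b => by
      ext (i | i) <;> simp only [Sum.elim_inl, Sum.elim_inr, Pi.smul_apply, smul_eq_mul] <;>
        rw [triple_cyclic, triple_smul, ← triple_cyclic]
      ring)
    (fun a b b' => by
      ext (i | i) <;> simp only [Sum.elim_inl, Sum.elim_inr, Pi.add_apply] <;>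
        rw [← triple_cyclic, triple_add, triple_cyclic, triple_cyclic p _ a b']
      ring)
    (fun t a b => by
      ext (i | i) <;> simp only [Sum.elim_inl, Sum.elim_inr, Pi.smul_apply, smul_eq_mul] <;>
        rw [← triple_cyclic, triple_smul, triple_cyclic]
      ring)

theorem stdForm_presentedMul (a b c : Fin n ⊕ Fin n → F) :
    stdForm F n (presentedMul p a b) c = triple p a b c := by
  let T : (Fin n ⊕ Fin n → F) →ₗ[F] F :=
    { toFun := triple p a b
      map_add' := triple_add p a b
      map_smul' := fun t c => triple_smul p t a b c }
  have h : T c = ∑ i, c i • T (Pi.single i 1) := by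
    conv_lhs => rw [pi_eq_sum_univ' c]
    simp [map_sum]
  change _ = T c
  rw [h, Fintype.sum_sum_type, ← Finset.sum_add_distrib]
  simp only [stdForm, presentedMul, LinearMap.mk₂_apply, Sum.elim_inl, Sum.elim_inr, smul_eq_mul]
  refine Finset.sum_congr rfl fun i _ => ?_
  change _ = c (.inl i) * triple p a b _ + c (.inr i) * triple p a b _
  ring

/-- The symplectic alternating algebra given by the presentation with triple values `p`:
its standard basis is the canonical basis of coordinate space, and `(uᵢ·uⱼ, uₖ) = p i j k`
for `i < j < k`. -/
def presented : SAA F (Fin n ⊕ Fin n → F) where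
  form := stdForm F n
  mul := presentedMul p
  form_alt x := by
    simp only [stdForm, LinearMap.mk₂_apply]
    exact Finset.sum_eq_zero fun i _ => by ring
  form_nondeg := by
    constructor
    · intro a h
      ext (i | i)
      · simpa [stdForm, Pi.single_apply] using h (Pi.single (.inr i) 1)
      · simpa [stdForm, Pi.single_apply] using h (Pi.single (.inl i) 1)
    · intro a h
      ext (i | i)
      · simpa [stdForm, Pi.single_apply] using h (Pi.single (.inr i) 1)
      · simpa [stdForm, Pi.single_apply] using h (Pi.single (.inl i) 1)
  mul_alt x := by
    ext (i | i) <;> simp [presentedMul, triple_self]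
  cyclic x y z := by
    rw [stdForm_presentedMul, stdForm_presentedMul, triple_cyclic]

theorem presented_hasPresentation : (presented p).HasPresentation p := by
  refine ⟨Pi.basisFun F _, ⟨?_, ?_, ?_⟩, ?_⟩
  · intro i j; simp [presented, stdForm, Pi.single_apply]
  · intro i j; simp [presented, stdForm, Pi.single_apply]
  · intro i j; simp [presented, stdForm, Pi.single_apply, eq_comm]
  · intro i j k hij hjk
    change stdForm F n (presentedMul p _ _) _ = _
    rw [stdForm_presentedMul]
    unfold triple
    have key : ∀ u v w : Fin n ⊕ Fin n, toLex u < toLex v → toLex v < toLex w →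
        minor u v w (Pi.basisFun F _ i) (Pi.basisFun F _ j) (Pi.basisFun F _ k)
          = if u = i ∧ v = j ∧ w = k then 1 else 0 := by
      intro u v w huv hvw
      simp only [minor, Pi.basisFun_apply, Pi.single_apply]
      have hi := lt_trans hij hjk
      have hu := lt_trans huv hvw
      by_cases h1 : u = i
      · subst h1
        have : v ≠ u := by rintro rfl; exact lt_irrefl _ huv
        have : w ≠ u := by rintro rfl; exact lt_irrefl _ hu
        have : u ≠ j := by rintro rfl; exact lt_irrefl _ hij
        have : u ≠ k := by rintro rfl; exact lt_irrefl _ hi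
        by_cases h2 : v = j
        · subst h2
          have : w ≠ v := by rintro rfl; exact lt_irrefl _ hvw
          have : v ≠ k := by rintro rfl; exact lt_irrefl _ hjk
          simp [*]
        · by_cases h3 : w = j
          · subst h3
            have : v ≠ k := by rintro rfl; exact lt_asymm hjk hvw
            simp [*]
          · simp [*]
      · by_cases h2 : v = i
        · subst h2
          have : u ≠ j := by rintro rfl; exact lt_asymm hij huv
          have : u ≠ k := by rintro rfl; exact lt_asymm hi huv
          simp [*]
        · by_cases h3 : w = i
          · subst h3
            have : u ≠ j := by rintro rfl; exact lt_asymm hij hu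
            have : u ≠ k := by rintro rfl; exact lt_asymm hi hu
            simp [*]
          · simp [*]
    rw [Fintype.sum_eq_single i, Fintype.sum_eq_single j, Fintype.sum_eq_single k]
    · rw [if_pos ⟨hij, hjk⟩, key i j k hij hjk]; simp
    · intro w hw
      split_ifs with h
      · rw [key _ _ _ h.1 h.2]; simp [hw]
      · rfl
    · intro v hv
      refine Finset.sum_eq_zero fun w _ => ?_
      split_ifs with h
      · rw [key _ _ _ h.1 h.2]; simp [hv]
      · rfl
    · intro u hu
      refine Finset.sum_eq_zero fun v _ => Finset.sum_eq_zero fun w _ => ?_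
      split_ifs with h
      · rw [key _ _ _ h.1 h.2]; simp [hu]
      · rfl

end Presented

end SAA

/-- The triple values of `𝒫₁₀^{(3,9)}(γ, r, s)`; the indices are shifted by one (`.inl 1` is `x₂`,
`.inr 3` is `y₄`), and all the values that are not listed are `0`. -/
def presentation39 {F : Type*} [Field F] (γ r s : F) :
    Fin 5 ⊕ Fin 5 → Fin 5 ⊕ Fin 5 → Fin 5 ⊕ Fin 5 → F
  | .inl 1, .inr 3, .inr 4 => γ
  | .inl 0, .inr 2, .inr 3 => r
  | .inl 0, .inr 2, .inr 4 => s
  | .inl 0, .inr 1, .inr 3 => 1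
  | .inr 0, .inr 1, .inr 4 => 1
  | .inr 0, .inr 2, .inr 3 => 1
  | _, _, _ => 0

/-- `H(r) = {x² + r x}`. -/
def groupH {F : Type*} [Field F] (r : F) : Set F := {z | ∃ x : F, z = x ^ 2 + r * x}

/-- `G(r, s) = {x² + r x y + s y² : (x, y) ≠ (0, 0)}`. -/
def groupG {F : Type*} [Field F] (r s : F) : Set F :=
  {z | ∃ x y : F, (x, y) ≠ (0, 0) ∧ z = x ^ 2 + r * x * y + s * y ^ 2}

/-! Everything rests on duality: `upper_eq_orthogonal` says that Zₙ is the orthogonal complement of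
Lⁿ⁺¹. When the centre is isotropic of dimension 3 and dim L³ = 6, it yields L⁵ ≤ Z ≤ Z₂ ≤ L³ ≤ L²,
with L³L³ = 0, Z₂L² = 0 and L³/Z₂ a symplectic plane (`IsCenterThree`).

Existence. In the case at hand, multiplication by y₂ identifies this plane with L⁵, and τ becomes an
operator σ on the plane with vy₃ = (σv)y₂ and σ² + rσ + s = 0. Pick y₁ with y₁y₂ ≠ 0 and x₁ = σy₁.
As σ has no eigenvector, x₄ = x₁y₂ and x₅ = y₁y₂ form a basis of L⁵, and the products y₁y₃ = x₄,
x₁y₃ = rx₄ + sx₅ are forced. Rescaling gives (x₁,y₁) = 1. The other basis vectors are dual vectors,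
corrected so that all remaining triple values vanish except γ = (x₂y₄,y₅); γ = 0 would put x₂ in the
centre, which is orthogonal to L².

Classification. Up to lower terms a change of basis is y₂ ↦ cy₂, y₃ ↦ ay₃ + by₂ and a map of the
plane of determinant 1. It replaces σ by σ' = (aσ + b)/c, of trace r' = ar/c and determinant s' =
(a² s + abr + b²)/c² in characteristic 2: this is the condition on H(r'). With N(v) = (σv,v), that
is β² + rαβ + sα² at v = αx₁ + βy₁, the normalization (σ'y₁',y₁') = 1 reads N(y₁') = c/a, so r'/r =
a/c is a value of N: this is the condition on G(r,s). Finally x₂ scales by c⁻¹ and y₄ ∧ y₅ by c⁻²,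
so γ' = c⁻³γ. The two directions are `invariants_of_isomorphic` and `isomorphic_of_invariants`. -/

namespace SAA

/-! ### Duality between the two central series, and symmetry in characteristic 2. -/

section CharTwo

variable {F L : Type*} [Field F] [AddCommGroup L] [Module F L]

theorem form_isAlt (A : SAA F L) : A.form.IsAlt := A.form_alt

theorem form_isRefl (A : SAA F L) : A.form.IsRefl := A.form_isAlt.isRefl

theorem mul_eq_neg (A : SAA F L) (x y : L) : A.mul x y = -A.mul y x := by
  have h := A.mul_alt (x + y)
  simp only [map_add, LinearMap.add_apply, A.mul_alt, zero_add, add_zero] at h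
  exact eq_neg_of_add_eq_zero_right h

theorem form_mul_self (A : SAA F L) (x y : L) : A.form (A.mul x y) x = 0 := by
  rw [← A.cyclic, A.mul_alt]; simp

theorem form_mul_self' (A : SAA F L) (x y : L) : A.form (A.mul x y) y = 0 := by
  rw [A.cyclic, A.mul_alt]; simp

theorem eq_zero_of_form (A : SAA F L) {x : L} (h : ∀ y, A.form x y = 0) : x = 0 :=
  A.form_nondeg.1 x h

theorem mem_upper_succ (A : SAA F L) {n : ℕ} {x : L} :
    x ∈ A.upper (n + 1) ↔ ∀ y, A.mul x y ∈ A.upper n := by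
  simp [upper]

theorem upper_zero (A : SAA F L) : A.upper 0 = ⊥ := rfl

theorem pow_succ_succ (A : SAA F L) (n : ℕ) : A.pow (n + 2) = A.prod (A.pow (n + 1)) ⊤ := rfl

theorem mul_mem_pow (A : SAA F L) {n : ℕ} {x : L} (hx : x ∈ A.pow (n + 1)) (y : L) :
    A.mul x y ∈ A.pow (n + 2) :=
  Submodule.apply_mem_map₂ _ hx trivial

theorem mem_orthogonal (A : SAA F L) {P : Submodule F L} {x : L} :
    x ∈ A.form.orthogonal P ↔ ∀ y ∈ P, A.form x y = 0 := by
  rw [LinearMap.BilinForm.mem_orthogonal_iff]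
  exact ⟨fun h y hy => A.form_isRefl _ _ (h y hy), fun h y hy => A.form_isRefl _ _ (h y hy)⟩

theorem mem_orthogonal_prod (A : SAA F L) {P Q : Submodule F L} {x : L} :
    x ∈ A.form.orthogonal (A.prod P Q) ↔ ∀ p ∈ P, ∀ q ∈ Q, A.form (A.mul p q) x = 0 := by
  constructor
  · intro h p hp q hq
    exact h _ (Submodule.apply_mem_map₂ _ hp hq)
  · intro h
    have : A.prod P Q ≤ LinearMap.ker (A.form.flip x) :=
      Submodule.map₂_le.2 fun p hp q hq => by simpa using h p hp q hq
    intro n hn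
    simpa using this hn

/-- Induction on n: (xy, p) = ±(py, x), so xL is orthogonal to Lⁿ⁺¹ exactly when x is orthogonal to
Lⁿ⁺¹L. -/
theorem upper_eq_orthogonal (A : SAA F L) (n : ℕ) :
    A.upper n = A.form.orthogonal (A.pow (n + 1)) := by
  induction n with
  | zero =>
    change ⊥ = A.form.orthogonal ⊤
    rw [LinearMap.BilinForm.orthogonal_top_eq_bot A.form_nondeg]
  | succ n ih =>
    ext x
    rw [mem_upper_succ, pow_succ_succ, mem_orthogonal_prod]
    simp only [ih, mem_orthogonal]
    constructor
    · intro h p hp q _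
      rw [A.cyclic, A.mul_eq_neg, map_neg, LinearMap.neg_apply, h q p hp, neg_zero]
    · intro h y p hp
      rw [A.cyclic, A.mul_eq_neg, map_neg, LinearMap.neg_apply, h p hp y trivial, neg_zero]

theorem center_eq_upper (A : SAA F L) : A.center = A.upper 1 := by
  ext x
  simp [center, mem_upper_succ, upper_zero, LinearMap.ext_iff]

theorem neg_eq_of_charP_two (F : Type*) {L : Type*} [Field F] [CharP F 2] [AddCommGroup L]
    [Module F L] (x : L) : -x = x := by
  rw [← neg_one_smul F, CharTwo.neg_eq, one_smul]

variable [CharP F 2]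

theorem form_comm (A : SAA F L) (x y : L) : A.form x y = A.form y x := by
  rw [← A.form_isAlt.neg_eq y x, CharTwo.neg_eq]

theorem mul_comm (A : SAA F L) (x y : L) : A.mul x y = A.mul y x := by
  rw [mul_eq_neg, neg_eq_of_charP_two F]

theorem form_mul_right_comm (A : SAA F L) (x y z : L) :
    A.form (A.mul x y) z = A.form (A.mul x z) y := by
  rw [A.mul_comm x y, A.cyclic]

end CharTwo

/-! ### The presented algebras in coordinates and their upper central series. -/

section Presentation

variable {F : Type*} [Field F]

theorem stdForm_five (a b : Fin 5 ⊕ Fin 5 → F) :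
    stdForm F 5 a b = a (.inl 0) * b (.inr 0) - a (.inr 0) * b (.inl 0)
      + (a (.inl 1) * b (.inr 1) - a (.inr 1) * b (.inl 1))
      + (a (.inl 2) * b (.inr 2) - a (.inr 2) * b (.inl 2))
      + (a (.inl 3) * b (.inr 3) - a (.inr 3) * b (.inl 3))
      + (a (.inl 4) * b (.inr 4) - a (.inr 4) * b (.inl 4)) := by
  simp only [stdForm, LinearMap.mk₂_apply, Fin.sum_univ_five]

theorem triple_presentation39 (γ r s : F) (a b c : Fin 5 ⊕ Fin 5 → F) :
    triple (presentation39 γ r s) a b c =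
      γ * minor (.inl 1) (.inr 3) (.inr 4) a b c + r * minor (.inl 0) (.inr 2) (.inr 3) a b c
      + s * minor (.inl 0) (.inr 2) (.inr 4) a b c + minor (.inl 0) (.inr 1) (.inr 3) a b c
      + minor (.inr 0) (.inr 1) (.inr 4) a b c + minor (.inr 0) (.inr 2) (.inr 3) a b c := by
  unfold triple
  simp only [Fintype.sum_sum_type, Fin.sum_univ_five, presentation39, zero_mul, ite_self, add_zero,
    zero_add, Sum.Lex.inr_lt_inr_iff, Sum.Lex.inl_lt_inr]
  simp
  ring

theorem presented_mul_apply (γ r s : F) (a b : Fin 5 ⊕ Fin 5 → F) :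
    (presented (presentation39 γ r s)).mul a b = Sum.elim
      ![a (.inr 1) * b (.inr 4) - a (.inr 4) * b (.inr 1)
          + (a (.inr 2) * b (.inr 3) - a (.inr 3) * b (.inr 2)),
        -(a (.inl 0) * b (.inr 3) - a (.inr 3) * b (.inl 0))
          - (a (.inr 0) * b (.inr 4) - a (.inr 4) * b (.inr 0)),
        -r * (a (.inl 0) * b (.inr 3) - a (.inr 3) * b (.inl 0))
          - s * (a (.inl 0) * b (.inr 4) - a (.inr 4) * b (.inl 0))
          - (a (.inr 0) * b (.inr 3) - a (.inr 3) * b (.inr 0)),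
        -γ * (a (.inl 1) * b (.inr 4) - a (.inr 4) * b (.inl 1))
          + r * (a (.inl 0) * b (.inr 2) - a (.inr 2) * b (.inl 0))
          + (a (.inl 0) * b (.inr 1) - a (.inr 1) * b (.inl 0))
          + (a (.inr 0) * b (.inr 2) - a (.inr 2) * b (.inr 0)),
        γ * (a (.inl 1) * b (.inr 3) - a (.inr 3) * b (.inl 1))
          + s * (a (.inl 0) * b (.inr 2) - a (.inr 2) * b (.inl 0))
          + (a (.inr 0) * b (.inr 1) - a (.inr 1) * b (.inr 0))]
      ![-(r * (a (.inr 2) * b (.inr 3) - a (.inr 3) * b (.inr 2))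
          + s * (a (.inr 2) * b (.inr 4) - a (.inr 4) * b (.inr 2))
          + (a (.inr 1) * b (.inr 3) - a (.inr 3) * b (.inr 1))),
        -γ * (a (.inr 3) * b (.inr 4) - a (.inr 4) * b (.inr 3)), 0, 0, 0] := by
  ext i
  simp only [presented, presentedMul, LinearMap.mk₂_apply, triple_presentation39, minor]
  rcases i with i | i <;> fin_cases i <;> simp [Pi.single_apply, -mul_eq_mul_left_iff] <;> ring

/-- An isomorphism preserves the upper central series, so this description and the three that follow
force many coordinates of the images of basis vectors to vanish. Products with a few basis vectors
already give all the equations. -/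
theorem mem_upper_one_presented {γ r s : F} (hγ : γ ≠ 0) (hs : s ≠ 0) (v : Fin 5 ⊕ Fin 5 → F) :
    v ∈ (presented (presentation39 γ r s)).upper 1 ↔
      v (.inl 0) = 0 ∧ v (.inl 1) = 0 ∧ ∀ i, v (.inr i) = 0 := by
  simp only [mem_upper_succ, upper_zero, Submodule.mem_bot, presented_mul_apply]
  constructor
  · intro h
    have h1 := h (Pi.single (.inr 1) 1)
    have h2 := h (Pi.single (.inr 4) 1)
    have h3 := h (Pi.single (.inl 1) 1)
    have h4 := h (Pi.single (.inl 0) 1)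
    simp [funext_iff, Fin.forall_fin_succ, hγ, hs] at h1 h2 h3 h4
    simp_all [Fin.forall_fin_succ]
  · rintro ⟨h1, h2, h3⟩ y
    ext (i | i) <;> fin_cases i <;> simp [h1, h2, h3]

theorem mem_upper_two_presented {γ r s : F} (hγ : γ ≠ 0) (hs : s ≠ 0) (v : Fin 5 ⊕ Fin 5 → F) :
    v ∈ (presented (presentation39 γ r s)).upper 2 ↔
      v (.inl 0) = 0 ∧ ∀ i, v (.inr i) = 0 := by
  rw [mem_upper_succ]
  simp only [mem_upper_one_presented hγ hs, presented_mul_apply]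
  constructor
  · intro h
    have h1 := h (Pi.single (.inr 1) 1)
    have h2 := h (Pi.single (.inr 4) 1)
    have h3 := h (Pi.single (.inr 3) 1)
    have h4 := h (Pi.single (.inl 0) 1)
    simp [Fin.forall_fin_succ, hγ, hs] at h1 h2 h3 h4
    simp_all [Fin.forall_fin_succ]
  · rintro ⟨h1, h3⟩ y
    refine ⟨?_, ?_, fun i => ?_⟩
    · simp [h1, h3]
    · simp [h1, h3]
    · fin_cases i <;> simp [h1, h3]

theorem mem_upper_three_presented {γ r s : F} (hγ : γ ≠ 0) (hs : s ≠ 0) (v : Fin 5 ⊕ Fin 5 → F) :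
    v ∈ (presented (presentation39 γ r s)).upper 3 ↔
      v (.inr 1) = 0 ∧ v (.inr 2) = 0 ∧ v (.inr 3) = 0 ∧ v (.inr 4) = 0 := by
  rw [mem_upper_succ]
  simp only [mem_upper_two_presented hγ hs, presented_mul_apply]
  constructor
  · intro h
    have h1 := h (Pi.single (.inr 1) 1)
    have h2 := h (Pi.single (.inr 2) 1)
    have h3 := h (Pi.single (.inr 3) 1)
    have h4 := h (Pi.single (.inr 4) 1)
    simp [Fin.forall_fin_succ, hγ, hs] at h1 h2 h3 h4
    simp_all
  · rintro ⟨h1, h2, h3, h4⟩ y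
    refine ⟨?_, fun i => ?_⟩
    · simp [h1, h2, h3, h4]
    · fin_cases i <;> simp [h1, h2, h3, h4]

theorem mem_upper_four_presented {γ r s : F} (hγ : γ ≠ 0) (hs : s ≠ 0) (v : Fin 5 ⊕ Fin 5 → F) :
    v ∈ (presented (presentation39 γ r s)).upper 4 ↔ v (.inr 3) = 0 ∧ v (.inr 4) = 0 := by
  rw [mem_upper_succ]
  simp only [mem_upper_three_presented hγ hs, presented_mul_apply]
  constructor
  · intro h
    have h1 := h (Pi.single (.inr 3) 1)
    have h2 := h (Pi.single (.inr 4) 1)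
    simp [hγ] at h1 h2
    exact ⟨h2, h1⟩
  · rintro ⟨h1, h2⟩ y
    simp [h1, h2]

end Presentation

/-! ### Criteria for isomorphisms. -/

section Isomorphism

variable {F L L' : Type*} [Field F] [AddCommGroup L] [Module F L] [AddCommGroup L'] [Module F L']

theorem map_mem_upper {A : SAA F L} {B : SAA F L'} (e : L ≃ₗ[F] L')
    (he : ∀ x y, e (A.mul x y) = B.mul (e x) (e y)) (n : ℕ) (x : L) :
    e x ∈ B.upper n ↔ x ∈ A.upper n := by
  induction n generalizing x with
  | zero => simp [upper_zero]
  | succ n ih =>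
    rw [mem_upper_succ, mem_upper_succ]
    refine ⟨fun h y => ?_, fun h y => ?_⟩
    · rw [← ih, he]; exact h (e y)
    · obtain ⟨z, rfl⟩ := e.surjective y
      rw [← he, ih]; exact h z

/-- In finite dimension, a linear map that preserves the form and the triple values is an
isomorphism. -/
theorem isomorphic_of_form_eq [FiniteDimensional F L] [FiniteDimensional F L']
    (hd : Module.finrank F L = Module.finrank F L') (A : SAA F L) (B : SAA F L') (e : L →ₗ[F] L')
    (hf : ∀ x y, B.form (e x) (e y) = A.form x y)
    (hm : ∀ x y z, B.form (B.mul (e x) (e y)) (e z) = A.form (A.mul x y) z) :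
    A.Isomorphic B := by
  have hinj : Function.Injective e := by
    rw [injective_iff_map_eq_zero]
    intro x hx
    refine A.eq_zero_of_form fun y => ?_
    rw [← hf, hx]; simp
  let e' := LinearEquiv.ofInjectiveOfFinrankEq e hinj hd
  refine ⟨e', hf, fun x y => ?_⟩
  rw [← sub_eq_zero]
  refine B.eq_zero_of_form fun w => ?_
  obtain ⟨z, rfl⟩ := e'.surjective w
  rw [map_sub, LinearMap.sub_apply, sub_eq_zero]
  exact (hf _ _).trans (hm x y z).symm

end Isomorphism

/-! ### Irreducible quadratics; necessity of the three conditions. -/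

section Classification

variable {F : Type*} [Field F]

theorem eval_ne_zero_of_irreducible {r s : F} (h : Irreducible (X ^ 2 + C r * X + C s)) (x : F) :
    x ^ 2 + r * x + s ≠ 0 := by
  intro hx
  have hd : (X ^ 2 + C r * X + C s).natDegree = 2 := by compute_degree!
  have hm : (X ^ 2 + C r * X + C s).Monic := by monicity!
  rw [hm.irreducible_iff_roots_eq_zero_of_degree_le_three (by omega) (by omega)] at h
  have : x ∈ (X ^ 2 + C r * X + C s).roots := by
    rw [mem_roots hm.ne_zero]; simpa [IsRoot.def] using hx
  simp [h] at this

theorem const_ne_zero_of_irreducible {r s : F} (h : Irreducible (X ^ 2 + C r * X + C s)) :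
    s ≠ 0 := by
  simpa using eval_ne_zero_of_irreducible h 0

theorem irreducible_of_eval_ne_zero {r s : F} (h : ∀ x : F, x ^ 2 + r * x + s ≠ 0) :
    Irreducible (X ^ 2 + C r * X + C s) := by
  have hd : (X ^ 2 + C r * X + C s).natDegree = 2 := by compute_degree!
  have hm : (X ^ 2 + C r * X + C s).Monic := by monicity!
  rw [hm.irreducible_iff_roots_eq_zero_of_degree_le_three (by omega) (by omega)]
  refine Multiset.eq_zero_of_forall_notMem fun x hx => h x ?_
  simpa using (mem_roots'.1 hx).2

variable [CharP F 2]

/-- Only leading coordinates matter: x₁ ↦ αx₁ + βy₁ and y₁ ↦ α'x₁ + β'y₁ modulo Z₂, y₂ ↦ cy₂ and y₃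
↦ ay₃ + by₂ modulo Z₃. The conditions come from comparing trace and determinant of σ' = (aσ + b)/c
with those of σ. -/
theorem invariants_of_isomorphic {γ r s γ' r' s' : F} (hγ : γ ≠ 0) (hs : s ≠ 0) (hr : r ≠ 0)
    (hγ' : γ' ≠ 0) (hs' : s' ≠ 0)
    (h : (presented (presentation39 γ' r' s')).Isomorphic (presented (presentation39 γ r s))) :
    (∃ c : F, c ≠ 0 ∧ γ' / γ = c ^ 3) ∧ r' / r ∈ groupG r s ∧
      s' - (r' / r) ^ 2 * s ∈ groupH r' := by
  obtain ⟨e, hf, hm⟩ := h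
  set u : Fin 5 ⊕ Fin 5 → Fin 5 ⊕ Fin 5 → F := fun i => e (Pi.single i 1) with hu
  have hZ4 := (mem_upper_four_presented hγ hs _).1
    ((map_mem_upper e hm 4 (Pi.single (.inr 2) 1)).2
      ((mem_upper_four_presented hγ' hs' _).2 (by simp)))
  have hx1 := (mem_upper_three_presented hγ hs _).1
    ((map_mem_upper e hm 3 (Pi.single (.inl 0) 1)).2
      ((mem_upper_three_presented hγ' hs' _).2 (by simp)))
  have hy1 := (mem_upper_three_presented hγ hs _).1
    ((map_mem_upper e hm 3 (Pi.single (.inr 0) 1)).2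
      ((mem_upper_three_presented hγ' hs' _).2 (by simp)))
  have hx2 := (mem_upper_two_presented hγ hs _).1
    ((map_mem_upper e hm 2 (Pi.single (.inl 1) 1)).2
      ((mem_upper_two_presented hγ' hs' _).2 (by simp)))
  -- y₂ is orthogonal to the centre, hence so is its image, which therefore has no component along
  -- y₃, y₄, y₅.
  have hy2 : ∀ w ∈ (presented (presentation39 γ r s)).upper 1,
      stdForm F 5 (e (Pi.single (.inr 1) 1)) w = 0 := by
    intro w hw
    obtain ⟨v, rfl⟩ := e.surjective w
    rw [map_mem_upper e hm 1, mem_upper_one_presented hγ' hs'] at hw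
    rw [show stdForm F 5 (e (Pi.single (.inr 1) 1)) (e v) = _ from hf _ _]
    change stdForm F 5 _ _ = 0
    simp [stdForm_five, hw]
  simp only [mem_upper_one_presented hγ hs] at hy2
  have hy23 := hy2 (Pi.single (.inl 2) 1) (by simp)
  have hy24 := hy2 (Pi.single (.inl 3) 1) (by simp)
  have hy25 := hy2 (Pi.single (.inl 4) 1) (by simp)
  simp [stdForm_five] at hy23 hy24 hy25
  have hfu : ∀ i j, stdForm F 5 (u i) (u j) = stdForm F 5 (Pi.single i 1) (Pi.single j 1) :=
    fun i j => hf _ _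
  have hmu : ∀ i j, (presented (presentation39 γ r s)).mul (u i) (u j) =
    e ((presented (presentation39 γ' r' s')).mul (Pi.single i 1) (Pi.single j 1)) :=
    fun i j => (hm _ _).symm
  have f1 := hfu (.inl 0) (.inr 0)
  have f2 := hfu (.inl 1) (.inr 1)
  have f3 := hfu (.inl 3) (.inr 3)
  have f4 := hfu (.inl 3) (.inr 4)
  have f5 := hfu (.inl 4) (.inr 3)
  have f6 := hfu (.inl 4) (.inr 4)
  have m1 : (presented (presentation39 γ r s)).mul (u (.inl 0)) (u (.inr 1)) = u (.inl 3) := by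
    rw [hmu, presented_mul_apply]
    congr 1
    ext (i | i) <;> fin_cases i <;> simp
  have m2 : (presented (presentation39 γ r s)).mul (u (.inr 0)) (u (.inr 1)) = u (.inl 4) := by
    rw [hmu, presented_mul_apply]
    congr 1
    ext (i | i) <;> fin_cases i <;> simp
  have m3 : (presented (presentation39 γ r s)).mul (u (.inl 0)) (u (.inr 2))
      = r' • u (.inl 3) + s' • u (.inl 4) := by
    rw [hmu, presented_mul_apply, ← map_smul, ← map_smul, ← map_add]
    congr 1
    ext (i | i) <;> fin_cases i <;> simp
  have m4 : (presented (presentation39 γ r s)).mul (u (.inr 0)) (u (.inr 2)) = u (.inl 3) := by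
    rw [hmu, presented_mul_apply]
    congr 1
    ext (i | i) <;> fin_cases i <;> simp
  have t1 : triple (presentation39 γ r s) (u (.inl 1)) (u (.inr 3)) (u (.inr 4)) = γ' := by
    rw [← stdForm_presentedMul]
    change stdForm F 5 ((presented (presentation39 γ r s)).mul _ _) _ = _
    rw [hmu]
    refine (hf _ _).trans ?_
    change stdForm F 5 (presentedMul _ _ _) _ = _
    rw [stdForm_presentedMul, triple_presentation39]
    simp [minor]
  rw [triple_presentation39] at t1
  rw [← m1, ← m2] at m3
  rw [← m1] at m4 f3 f4
  rw [← m2] at f5 f6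
  replace hZ4 : u (.inr 2) (.inr 3) = 0 ∧ u (.inr 2) (.inr 4) = 0 := hZ4
  replace hx1 : u (.inl 0) (.inr 1) = 0 ∧ u (.inl 0) (.inr 2) = 0 ∧ u (.inl 0) (.inr 3) = 0 ∧
    u (.inl 0) (.inr 4) = 0 := hx1
  replace hy1 : u (.inr 0) (.inr 1) = 0 ∧ u (.inr 0) (.inr 2) = 0 ∧ u (.inr 0) (.inr 3) = 0 ∧
    u (.inr 0) (.inr 4) = 0 := hy1
  replace hx2 : u (.inl 1) (.inl 0) = 0 ∧ ∀ i, u (.inl 1) (.inr i) = 0 := hx2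
  replace hy23 : u (.inr 1) (.inr 2) = 0 := hy23
  replace hy24 : u (.inr 1) (.inr 3) = 0 := hy24
  replace hy25 : u (.inr 1) (.inr 4) = 0 := hy25
  simp only [presented_mul_apply] at m3 m4 f3 f4 f5 f6
  have m31 := congrFun m3 (.inl 3)
  have m32 := congrFun m3 (.inl 4)
  have m41 := congrFun m4 (.inl 3)
  have m42 := congrFun m4 (.inl 4)
  simp [stdForm_five, minor, hx1, hy1, hx2, hZ4, hy23, hy24, hy25]
    at f1 f2 f3 f4 f5 f6 m31 m32 m41 m42 t1
  generalize u (.inl 0) (.inl 0) = α at *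
  generalize u (.inl 0) (.inr 0) = β at *
  generalize u (.inr 0) (.inl 0) = α' at *
  generalize u (.inr 0) (.inr 0) = β' at *
  generalize u (.inr 1) (.inr 1) = c at *
  generalize u (.inr 2) (.inr 1) = b at *
  generalize u (.inr 2) (.inr 2) = a at *
  generalize u (.inl 1) (.inl 1) = g at *
  generalize u (.inr 3) (.inr 3) = d₁ at *
  generalize u (.inr 3) (.inr 4) = d₂ at *
  generalize u (.inr 4) (.inr 3) = d₃ at *
  generalize u (.inr 4) (.inr 4) = d₄ at *
  clear hf hm m1 m2 m3 m4 hmu hfu hy2 hx1 hx2 hy1 hZ4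
  have h2 : (2 : F) = 0 := CharTwo.two_eq_zero
  have hg : g ≠ 0 := left_ne_zero_of_mul_eq_one f2
  have hc : c ≠ 0 := right_ne_zero_of_mul_eq_one f2
  -- The images of y₄, y₅ are dual to those of x₄, x₅, whose matrix is c times a matrix of
  -- determinant 1.
  have hD : c ^ 2 * (d₁ * d₄ - d₂ * d₃) = 1 := by
    linear_combination (α' * c * d₃ + β' * c * d₄) * f3 - (α' * c * d₁ + β' * c * d₂) * f4
      + f6 - c ^ 2 * (d₁ * d₄ - d₂ * d₃) * f1
  -- The trace of cσ' = aσ + b is ar + 2b = ar.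
  have hr' : c * r' = r * a := by
    linear_combination -β' * m31 + α' * m32 + β * m41 - α * m42 + (r * a + 2 * b - c * r') * f1
      + b * h2
  -- This is a·N(y₁') = c, that is (σ'y₁', y₁') = 1.
  have hN : c = a * (β' ^ 2 + r * β' * α' + s * α' ^ 2) := by
    linear_combination -c * f1 - β' * m41 + α' * m42 - a * s * α' ^ 2 * h2
  have ha : a ≠ 0 := by
    rintro rfl
    exact hc (by simpa using hN)
  have hcs : c * s' = a * (s * α ^ 2 - r * α * β - β ^ 2) := by
    linear_combination -α * m32 + β * m31 - c * s' * f1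
  -- The determinant of cσ' = aσ + b. As σ' commutes with σ, N(σ'v) = det(σ')·N(v); apply this to
  -- x₁' = σ'y₁', with `hcs` giving aN(x₁') = cs' and `hN` giving aN(y₁') = c.
  have hs'' : c ^ 2 * s' = a ^ 2 * s + a * b * r + b ^ 2 := by
    refine mul_left_cancel₀ hc ?_
    linear_combination c ^ 2 * hcs
      - a * s * (α * c + (r * (α' * a) + α' * b + β' * a)) * m41
      + a * r * ((r * (α' * a) + α' * b + β' * a) * m42 + β * c * m41)
      + a * (β * c + (s * (α' * a) + β' * b)) * m42
      - (a ^ 2 * s + a * b * r + b ^ 2) * hN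
      - a * (s ^ 2 * a ^ 2 * α' ^ 2 + (r ^ 2 * a * b + r * b ^ 2) * α' * β'
        + (r * a * b + b ^ 2) * β' ^ 2) * h2
  have hρ : r' / r = a / c := by
    field_simp
    linear_combination hr'
  refine ⟨⟨g, hg, ?_⟩, ?_, ?_⟩
  · rw [← t1]
    field_simp
    linear_combination (d₁ * d₄ - d₂ * d₃) * (-1 - g * c) * f2 + g ^ 2 * hD
  · rw [hρ]
    -- N takes the value c/a at (β', α'), so scaling the vector by a/c gives the value a/c.
    refine ⟨a * β' / c, a * α' / c, ?_, ?_⟩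
    · simp only [ne_eq, Prod.mk.injEq, not_and]
      intro h1 h3
      have h1 : β' = 0 := by simpa [ha, hc] using h1
      have h3 : α' = 0 := by simpa [ha, hc] using h3
      exact hc (by rw [hN, h1, h3]; ring)
    · field_simp
      linear_combination hN
  · rw [hρ]
    refine ⟨b / c, ?_⟩
    field_simp
    linear_combination hs'' - b * hr'

end Classification

/-! ### Sufficiency: an explicit change of basis. -/

section Classification

variable {F : Type*} [Field F] [CharP F 2]

/-- The change of basis `x₁ ↦ αx₁ + βy₁`, `y₁ ↦ α'x₁ + β'y₁`, `y₂ ↦ cy₂`, `y₃ ↦ ay₃ + by₂`,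
completed to the remaining vectors of a standard basis. -/
def changeOfBasis (α β α' β' a b c : F) : (Fin 5 ⊕ Fin 5 → F) →ₗ[F] (Fin 5 ⊕ Fin 5 → F) where
  toFun v := Sum.elim
    ![α * v (.inl 0) + α' * v (.inr 0),
      c⁻¹ * v (.inl 1),
      b * a⁻¹ * c⁻¹ * v (.inl 1) + a⁻¹ * v (.inl 2),
      c * α * v (.inl 3) + c * α' * v (.inl 4),
      c * β * v (.inl 3) + c * β' * v (.inl 4)]
    ![β * v (.inl 0) + β' * v (.inr 0),
      c * v (.inr 1) + b * v (.inr 2),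
      a * v (.inr 2),
      c⁻¹ * β' * v (.inr 3) + c⁻¹ * β * v (.inr 4),
      c⁻¹ * α' * v (.inr 3) + c⁻¹ * α * v (.inr 4)]
  map_add' v w := by
    ext (i | i) <;> fin_cases i <;> simp <;> ring
  map_smul' t v := by
    ext (i | i) <;> fin_cases i <;> simp <;> ring

/-- `hdet` is (x₁', y₁') = 1, while `hα` and `hβ` are the two coordinates of y₁'y₃' = x₁'y₂'. The
identities `e5` to `e8` compute c times the values of (x₁'y₃', ·) and (y₁'y₃', ·) on y₄' and y₅'. -/
theorem isomorphic_of_changeOfBasis {γ r s γ' r' s' α β α' β' a b c : F} (ha : a ≠ 0) (hc : c ≠ 0)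
    (hdet : α * β' + β * α' = 1) (hα : r * α' * a + α' * b + β' * a = α * c)
    (hβ : s * α' * a + β' * b = β * c) (hγ : γ' * c ^ 3 = γ) (hr : r' * c = r * a)
    (hs : s' * c ^ 2 = a ^ 2 * s + a * b * r + b ^ 2) :
    (presented (presentation39 γ' r' s')).Isomorphic (presented (presentation39 γ r s)) := by
  have h2 : (2 : F) = 0 := CharTwo.two_eq_zero
  have e5 : r * α * a * β' + s * α * a * α' + b * (α * β' + β * α') + β * a * β' = r' * c := by
    linear_combination α * hβ + β * hα + r * a * hdet - hr + (α * β * c - r * a * β * α') * h2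
  have e7 : r * α' * a * β' + s * α' * a * α' + 2 * b * α' * β' + a * β' ^ 2 = c := by
    linear_combination β' * hα + α' * hβ + c * hdet
  have e8 : r * α' * a * β + s * α' * a * α + b * (α' * β + β' * α) + a * β' * β = 0 := by
    linear_combination β * hα + α * hβ + α * β * c * h2
  -- The left side is aN(x₁') and that of `e7` is aN(y₁'), so this is N(σ'v) = det(σ')·N(v) once
  -- more.
  have e6 : r * α * a * β + s * α * a * α + 2 * b * α * β + a * β ^ 2 = s' * c := by
    refine mul_left_cancel₀ (pow_ne_zero 2 hc) ?_
    linear_combination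
      -a * s * (α * c + (r * α' * a + α' * b + β' * a)) * hα
      - a * r * ((r * α' * a + α' * b + β' * a) * hβ + β * c * hα)
      - a * (β * c + (s * α' * a + β' * b)) * hβ
      + (a ^ 2 * s + a * b * r + b ^ 2) * e7 - c * hs
      + (c ^ 2 * α * β * b - r * a * b ^ 2 * α' * β' + r * a ^ 2 * s * b * α' ^ 2
        + r * a ^ 3 * s * α' * β' + r ^ 2 * a ^ 3 * s * α' ^ 2 + a ^ 2 * s * b * α' * β'
        - b ^ 3 * α' * β') * h2
  have hcd : c * c⁻¹ = 1 := mul_inv_cancel₀ hc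
  have had : a * a⁻¹ = 1 := mul_inv_cancel₀ ha
  refine isomorphic_of_form_eq rfl _ _ (changeOfBasis α β α' β' a b c) (fun x y => ?_)
    (fun x y z => ?_)
  · change stdForm F 5 _ _ = stdForm F 5 _ _
    simp only [stdForm_five, changeOfBasis, LinearMap.coe_mk, AddHom.coe_mk, Sum.elim_inl,
      Sum.elim_inr, Matrix.cons_val, CharTwo.sub_eq_add]
    generalize c⁻¹ = d at *
    generalize a⁻¹ = t at *
    linear_combination ((x (.inl 0) * y (.inr 0) + x (.inr 0) * y (.inl 0))
        + c * d * ((x (.inl 3) * y (.inr 3) + x (.inr 3) * y (.inl 3))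
          + (x (.inl 4) * y (.inr 4) + x (.inr 4) * y (.inl 4)))) * hdet
      + ((x (.inl 1) * y (.inr 1) + x (.inr 1) * y (.inl 1)) + (x (.inl 3) * y (.inr 3) + x (.inr 3) * y (.inl 3))
        + (x (.inl 4) * y (.inr 4) + x (.inr 4) * y (.inl 4))) * hcd
      + ((x (.inl 2) * y (.inr 2) + x (.inr 2) * y (.inl 2))
        + d * b * (x (.inl 1) * y (.inr 2) + x (.inr 2) * y (.inl 1))) * had
      + (α * β * x (.inl 0) * y (.inl 0) + α' * β' * x (.inr 0) * y (.inr 0)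
        + α * β * d * c * (x (.inl 3) * y (.inr 4) + x (.inr 4) * y (.inl 3))
        + α' * β' * d * c * (x (.inl 4) * y (.inr 3) + x (.inr 3) * y (.inl 4))
        + d * b * (x (.inl 1) * y (.inr 2) + x (.inr 2) * y (.inl 1))) * h2
  -- `k0` to `k8` are the coefficients of the transformed trilinear form at the minors that occur;
  -- those of `k2`, `k3` and `k8` must vanish.
  · have k0 : γ * c⁻¹ ^ 3 * (α * β' - β * α') = γ' := by
      rw [CharTwo.sub_eq_add, hdet, ← hγ]; field_simp
    have k1 : c * c⁻¹ * (α * β' + β * α') = 1 := by rw [hcd, hdet, one_mul]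
    have k2 : c * c⁻¹ * (2 * α * β) = 0 := by rw [h2]; ring
    have k3 : c * c⁻¹ * (2 * α' * β') = 0 := by rw [h2]; ring
    have k5 : c⁻¹ * (r * α * a * β' + s * α * a * α' + b * (α * β' + β * α') + β * a * β') = r' := by
      rw [e5]; field_simp
    have k6 : c⁻¹ * (r * α * a * β + s * α * a * α + 2 * b * α * β + a * β ^ 2) = s' := by
      rw [e6]; field_simp
    have k7 : c⁻¹ * (r * α' * a * β' + s * α' * a * α' + 2 * b * α' * β' + a * β' ^ 2) = 1 := by
      rw [e7]; field_simp
    have k8 : c⁻¹ * (r * α' * a * β + s * α' * a * α + b * (α' * β + β' * α) + a * β' * β) = 0 := by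
      rw [e8]; ring
    change stdForm F 5 (presentedMul _ _ _) _ = stdForm F 5 (presentedMul _ _ _) _
    simp only [stdForm_presentedMul, triple_presentation39, changeOfBasis, LinearMap.coe_mk,
      AddHom.coe_mk, Sum.elim_inl, Sum.elim_inr, Matrix.cons_val, minor]
    have hmin : ∀ i j k, minor i j k x y z = x i * (y j * z k - y k * z j)
      - x j * (y i * z k - y k * z i) + x k * (y i * z j - y j * z i) := fun _ _ _ => rfl
    generalize c⁻¹ = d at *
    linear_combination (norm := (simp only [hmin]; ring1))
      k0 * minor (.inl 1) (.inr 3) (.inr 4) x y z + k1 * minor (.inl 0) (.inr 1) (.inr 3) x y z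
      + k2 * minor (.inl 0) (.inr 1) (.inr 4) x y z + k3 * minor (.inr 0) (.inr 1) (.inr 3) x y z
      + k1 * minor (.inr 0) (.inr 1) (.inr 4) x y z + k5 * minor (.inl 0) (.inr 2) (.inr 3) x y z
      + k6 * minor (.inl 0) (.inr 2) (.inr 4) x y z + k7 * minor (.inr 0) (.inr 2) (.inr 3) x y z
      + k8 * minor (.inr 0) (.inr 2) (.inr 4) x y z

theorem isomorphic_of_invariants {γ r s γ' r' s' : F} (hγ : γ ≠ 0) (hr : r ≠ 0) (hr' : r' ≠ 0)
    (h1 : ∃ c : F, c ≠ 0 ∧ γ' / γ = c ^ 3) (h3 : r' / r ∈ groupG r s)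
    (h4 : s' - (r' / r) ^ 2 * s ∈ groupH r') :
    (presented (presentation39 γ' r' s')).Isomorphic (presented (presentation39 γ r s)) := by
  have h2 : (2 : F) = 0 := CharTwo.two_eq_zero
  obtain ⟨k, hk, h1⟩ := h1
  obtain ⟨x, y, -, h3⟩ := h3
  obtain ⟨h, h4⟩ := h4
  obtain ⟨ρ, hρ⟩ : ∃ ρ, ρ = r' / r := ⟨_, rfl⟩
  have hρ0 : ρ ≠ 0 := hρ ▸ div_ne_zero hr' hr
  rw [← hρ] at h3 h4
  obtain rfl : r' = ρ * r := by rw [hρ]; field_simp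
  obtain rfl : γ' = k ^ 3 * γ := by rw [← h1]; field_simp
  have hs : s' = ρ ^ 2 * s + h ^ 2 + ρ * r * h := by linear_combination h4
  -- c = k⁻¹ gives γ' = c⁻³γ, and a/c = ρ, b/c = h are read off from r' and s'. Since N equals ρ at
  -- (x, y), it equals ρ⁻¹ = c/a at (x/ρ, y/ρ) = (β', α'). Then α, β are the coordinates of σ'y₁'.
  refine isomorphic_of_changeOfBasis (α := r * y + x + h * y / ρ) (β := s * y + h * x / ρ)
    (α' := y / ρ) (β' := x / ρ) (a := ρ * k⁻¹) (b := h * k⁻¹) (c := k⁻¹)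
    (mul_ne_zero hρ0 (inv_ne_zero hk)) (inv_ne_zero hk) ?_ ?_ ?_ ?_ ?_ ?_
  · field_simp
    linear_combination -ρ * h3 + h * x * y * h2
  · field_simp
    ring
  · field_simp
  · field_simp
  · field_simp
  · rw [hs]; field_simp
    ring

end Classification

/-! ### The flag of central-series terms when the centre has dimension 3. -/

section Flag

variable {F L : Type*} [Field F] [AddCommGroup L] [Module F L]

/-- If `Q` has dimension `dim P + n` and contains `P` and `n` vectors that are linearly independent
modulo `P`, then these vectors span `Q` modulo `P`. -/
theorem exists_sub_sum_mem [FiniteDimensional F L] {P Q : Submodule F L} (hPQ : P ≤ Q) {n : ℕ}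
    (hd : Module.finrank F Q = Module.finrank F P + n) (v : Fin n → L) (hv : ∀ i, v i ∈ Q)
    (hi : ∀ c : Fin n → F, ∑ i, c i • v i ∈ P → c = 0) {u : L} (hu : u ∈ Q) :
    ∃ z ∈ P, ∃ c : Fin n → F, u = z + ∑ i, c i • v i := by
  let g : (P × (Fin n → F)) →ₗ[F] L := P.subtype.coprod (Fintype.linearCombination F v)
  have hg : ∀ x, g x = x.1 + ∑ i, x.2 i • v i := fun x => by
    simp [g, Fintype.linearCombination_apply]
  have hinj : Function.Injective g := by
    rw [injective_iff_map_eq_zero]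
    rintro ⟨p, c⟩ h
    rw [hg] at h
    have hc : c = 0 := hi c (by
      rw [← neg_eq_of_add_eq_zero_right h]; exact P.neg_mem p.2)
    subst hc
    simpa using h
  have hle : LinearMap.range g ≤ Q := by
    rintro _ ⟨x, rfl⟩
    rw [hg]
    exact Q.add_mem (hPQ x.1.2) (Q.sum_mem fun i _ => Q.smul_mem _ (hv i))
  have heq : LinearMap.range g = Q := by
    refine Submodule.eq_of_le_of_finrank_eq hle ?_
    rw [LinearMap.finrank_range_of_inj hinj, hd]
    simp
  rw [← heq] at hu
  obtain ⟨x, rfl⟩ := hu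
  exact ⟨x.1, x.1.2, x.2, hg x⟩

theorem exists_eq_add_smul [FiniteDimensional F L] {P Q : Submodule F L} (hPQ : P ≤ Q)
    (hd : Module.finrank F Q = Module.finrank F P + 1) {y : L} (hy : y ∈ Q) (hyP : y ∉ P) {u : L}
    (hu : u ∈ Q) : ∃ z ∈ P, ∃ c : F, u = z + c • y := by
  obtain ⟨z, hz, c, rfl⟩ := exists_sub_sum_mem hPQ hd ![y] (by simpa using hy) (fun c hc => by
    ext i
    obtain rfl : i = 0 := Subsingleton.elim _ _
    by_contra h
    exact hyP ((P.smul_mem_iff h).1 (by simpa using hc))) hu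
  exact ⟨z, hz, c 0, by simp⟩

theorem exists_eq_add_smul_add_smul [FiniteDimensional F L] {P Q : Submodule F L} (hPQ : P ≤ Q)
    (hd : Module.finrank F Q = Module.finrank F P + 2) {x y : L} (hx : x ∈ Q) (hy : y ∈ Q)
    (hi : ∀ a b : F, a • x + b • y ∈ P → a = 0 ∧ b = 0) {u : L} (hu : u ∈ Q) :
    ∃ z ∈ P, ∃ a b : F, u = z + a • x + b • y := by
  obtain ⟨z, hz, c, rfl⟩ := exists_sub_sum_mem hPQ hd ![x, y] (by simp [Fin.forall_fin_succ, hx, hy])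
    (fun c hc => by
      obtain ⟨h0, h1⟩ := hi (c 0) (c 1) (by simpa using hc)
      ext i
      fin_cases i <;> simpa) hu
  exact ⟨z, hz, c 0, c 1, by simp [add_assoc]⟩

theorem pow_succ_le (A : SAA F L) (n : ℕ) : A.pow (n + 2) ≤ A.pow (n + 1) := by
  induction n with
  | zero => exact le_top
  | succ n ih => exact Submodule.map₂_le_map₂_left ih

theorem pow_antitone (A : SAA F L) {m n : ℕ} (h : m ≤ n) : A.pow (n + 1) ≤ A.pow (m + 1) :=
  antitone_nat_of_succ_le (f := fun n => A.pow (n + 1)) A.pow_succ_le h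

theorem pow_eq_bot_of_le (A : SAA F L) (hn : A.IsNilpotent) {n : ℕ}
    (h : A.pow (n + 1) ≤ A.pow (n + 2)) : A.pow (n + 1) = ⊥ := by
  have key : ∀ m, A.pow (n + 1) ≤ A.pow (m + 1) := by
    intro m
    induction m with
    | zero => exact le_top
    | succ m ih => exact h.trans (Submodule.map₂_le_map₂_left ih)
  obtain ⟨m, hm⟩ := hn
  cases m with
  | zero => exact eq_bot_mono le_top hm
  | succ m => exact eq_bot_mono (key m) hm

theorem center_le_upper_two (A : SAA F L) : A.center ≤ A.upper 2 := by
  rw [upper_eq_orthogonal, center_eq_upper, upper_eq_orthogonal]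
  exact LinearMap.BilinForm.orthogonal_le (A.pow_succ_le 1)

theorem form_eq_zero_of_mem_upper_two (A : SAA F L) {z u : L} (hz : z ∈ A.upper 2) (hu : u ∈ A.pow 3) :
    A.form z u = 0 := by
  rw [upper_eq_orthogonal, mem_orthogonal] at hz
  exact hz u hu

theorem form_eq_zero_of_mem_center (A : SAA F L) {z u : L} (hz : z ∈ A.center) (hu : u ∈ A.pow 2) :
    A.form z u = 0 := by
  rw [center_eq_upper, upper_eq_orthogonal, mem_orthogonal] at hz
  exact hz u hu

/-- (zv, w) = (vw, z) vanishes because vw ∈ L³ is orthogonal to Z₂. -/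
theorem mul_eq_zero_of_mem_upper_two (A : SAA F L) {z v : L} (hz : z ∈ A.upper 2) (hv : v ∈ A.pow 2) :
    A.mul z v = 0 := by
  refine A.eq_zero_of_form fun w => ?_
  rw [A.cyclic]
  exact A.form_isRefl _ _ (A.form_eq_zero_of_mem_upper_two hz (A.mul_mem_pow hv w))

/-- Nilpotent algebras of dimension `10` with an isotropic centre of dimension `3` and
`dim L³ = 6`. -/
structure IsCenterThree (A : SAA F L) : Prop where
  finrank_eq : Module.finrank F L = 10
  isNilpotent : A.IsNilpotent
  isIsotropic : A.IsIsotropic A.center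
  finrank_center : Module.finrank F A.center = 3
  finrank_pow_three : Module.finrank F (A.pow 3) = 6

namespace IsCenterThree

variable {A : SAA F L}

theorem finiteDimensional (h : A.IsCenterThree) : FiniteDimensional F L :=
  Module.finite_of_finrank_pos (by rw [h.finrank_eq]; norm_num)

theorem orthogonal_orthogonal (h : A.IsCenterThree) (P : Submodule F L) :
    A.form.orthogonal (A.form.orthogonal P) = P :=
  have := h.finiteDimensional
  LinearMap.BilinForm.orthogonal_orthogonal A.form_nondeg A.form_isRefl P

theorem finrank_orthogonal (h : A.IsCenterThree) (P : Submodule F L) :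
    Module.finrank F (A.form.orthogonal P) = 10 - Module.finrank F P := by
  have := h.finiteDimensional
  rw [LinearMap.BilinForm.finrank_orthogonal A.form_nondeg, h.finrank_eq]

theorem pow_eq_orthogonal (h : A.IsCenterThree) (n : ℕ) :
    A.pow (n + 1) = A.form.orthogonal (A.upper n) := by
  rw [upper_eq_orthogonal, h.orthogonal_orthogonal]

theorem finrank_pow_two (h : A.IsCenterThree) : Module.finrank F (A.pow 2) = 7 := by
  rw [h.pow_eq_orthogonal 1, h.finrank_orthogonal, ← center_eq_upper, h.finrank_center]

theorem finrank_upper_two (h : A.IsCenterThree) : Module.finrank F (A.upper 2) = 4 := by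
  rw [upper_eq_orthogonal, h.finrank_orthogonal, h.finrank_pow_three]

theorem center_le_pow_two (h : A.IsCenterThree) : A.center ≤ A.pow 2 := by
  intro x hx
  rw [h.pow_eq_orthogonal 1, mem_orthogonal, ← center_eq_upper]
  exact h.isIsotropic x hx

/-- dim L² = dim L³ + 1, so a central z outside L³ gives L² = L³ + ⟨z⟩. Then L³ = L²L = L³L = L⁴,
against nilpotency. -/
theorem center_le_pow_three (h : A.IsCenterThree) : A.center ≤ A.pow 3 := by
  have := h.finiteDimensional
  intro z hz
  by_contra hz3
  have hle : A.pow 3 ≤ A.pow 4 := by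
    refine Submodule.map₂_le.2 fun u hu w _ => ?_
    obtain ⟨p, hp, c, rfl⟩ := exists_eq_add_smul (A.pow_succ_le 1)
      (by rw [h.finrank_pow_two, h.finrank_pow_three]) (h.center_le_pow_two hz) hz3 hu
    have hz0 : A.mul z = 0 := hz
    simpa [hz0] using A.mul_mem_pow hp w
  have h3 := h.finrank_pow_three
  rw [A.pow_eq_bot_of_le h.isNilpotent hle, finrank_bot] at h3
  omega

/-- As L³ is the complement of Z₂, the claim is that Z₂ is isotropic. The centre lies in L³, hence
is orthogonal to Z₂, and Z₂ is the centre plus one further vector, orthogonal to itself. -/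
theorem upper_two_le_pow_three (h : A.IsCenterThree) : A.upper 2 ≤ A.pow 3 := by
  have := h.finiteDimensional
  have hd : Module.finrank F (A.upper 2) = Module.finrank F A.center + 1 := by
    rw [h.finrank_upper_two, h.finrank_center]
  obtain ⟨w, hw, hwz⟩ := Set.exists_of_ssubset (lt_of_le_of_ne A.center_le_upper_two (fun he => by
    rw [SetLike.coe_injective he] at hd; omega))
  intro a ha
  rw [h.pow_eq_orthogonal 2, mem_orthogonal]
  intro b hb
  have h0 : ∀ z ∈ A.center, ∀ b ∈ A.upper 2, A.form b z = 0 := fun z hz b hb =>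
    A.form_eq_zero_of_mem_upper_two hb (h.center_le_pow_three hz)
  obtain ⟨z', hz', c', rfl⟩ := exists_eq_add_smul A.center_le_upper_two hd hw hwz hb
  rw [map_add, h0 z' hz' a ha]
  obtain ⟨z, hz, c, rfl⟩ := exists_eq_add_smul A.center_le_upper_two hd hw hwz ha
  have := A.form_isRefl _ _ (h0 z hz w hw)
  simp [this, A.form_alt]

/-- Multiplication by a fixed element acts on the symplectic plane `L³ / Z₂(L)` as a scalar, which
vanishes because the algebra is nilpotent. -/
theorem mul_mem_upper_two (h : A.IsCenterThree) {u : L} (hu : u ∈ A.pow 3) (w : L) :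
    A.mul u w ∈ A.upper 2 := by
  have := h.finiteDimensional
  obtain ⟨p, hp, hpz⟩ := Set.exists_of_ssubset (lt_of_le_of_ne h.upper_two_le_pow_three (fun he => by
    have h3 := h.finrank_upper_two
    rw [SetLike.coe_injective he, h.finrank_pow_three] at h3; omega))
  have hpz' := hpz
  rw [SetLike.mem_coe, upper_eq_orthogonal, mem_orthogonal] at hpz'
  push Not at hpz'
  obtain ⟨q, hq, hpq⟩ := hpz'
  have hqp : A.form q p = -A.form p q := (A.form_isAlt.neg_eq p q).symm
  have hi : ∀ a b : F, a • p + b • q ∈ A.upper 2 → a = 0 ∧ b = 0 := by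
    intro a b hab
    have h1 := A.form_eq_zero_of_mem_upper_two hab hq
    have h2 := A.form_eq_zero_of_mem_upper_two hab hp
    simp [A.form_alt, hqp, hpq] at h1 h2
    exact ⟨h1, h2⟩
  have hdec : ∀ u ∈ A.pow 3, ∃ z ∈ A.upper 2, ∃ a b : F, u = z + a • p + b • q := fun u hu =>
    exists_eq_add_smul_add_smul h.upper_two_le_pow_three
      (by rw [h.finrank_upper_two, h.finrank_pow_three]) hp hq hi hu
  have hz1 : ∀ z ∈ A.upper 2, ∀ v ∈ A.pow 3, A.form (A.mul z w) v = 0 := by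
    intro z hz v hv
    refine A.form_eq_zero_of_mem_center ?_ (A.pow_succ_le 1 hv)
    rw [center_eq_upper]
    exact A.mem_upper_succ.1 hz w
  have hz2 : ∀ z ∈ A.upper 2, ∀ v ∈ A.pow 3, A.form (A.mul v w) z = 0 := by
    intro z hz v hv
    rw [A.cyclic, A.mul_eq_neg, map_neg, LinearMap.neg_apply, hz1 z hz v hv, neg_zero]
  have hz3 : ∀ z ∈ A.upper 2, ∀ v ∈ A.pow 3, A.form v z = 0 := fun z hz v hv =>
    A.form_isRefl _ _ (A.form_eq_zero_of_mem_upper_two hz hv)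
  -- (u, v) ↦ (uw, v) is alternating on the plane spanned by p and q modulo Z₂, hence t times the
  -- form.
  obtain ⟨t, ht⟩ : ∃ t, t = A.form (A.mul p w) q / A.form p q := ⟨_, rfl⟩
  have hsc : ∀ u ∈ A.pow 3, A.mul u w - t • u ∈ A.upper 2 := by
    intro u hu
    rw [upper_eq_orthogonal, mem_orthogonal]
    intro v hv
    obtain ⟨z', hz', a', b', rfl⟩ := hdec v hv
    obtain ⟨z, hz, a, b, rfl⟩ := hdec u hu
    have e3 := hz1 z hz p hp
    have e4 := hz1 z hz q hq
    have e5 := A.form_eq_zero_of_mem_upper_two hz hp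
    have e6 := A.form_eq_zero_of_mem_upper_two hz hq
    have e7 : A.form (A.mul q w) p = -A.form (A.mul p w) q := by
      rw [A.cyclic, A.mul_eq_neg, map_neg, LinearMap.neg_apply]
    have hz0 := h.upper_two_le_pow_three hz
    simp [e3, e4, e5, e6, e7, hz2 z' hz' p hp, hz2 z' hz' q hq, hz2 z' hz' z hz0, hz3 z' hz' p hp,
      hz3 z' hz' q hq, hz3 z' hz' z hz0, A.form_alt, A.form_mul_self, hqp, ht]
    field_simp
    ring
  suffices t = 0 by simpa [this] using hsc u hu
  by_contra ht0
  -- If t ≠ 0, then uw ≡ tu modulo Z₂ recovers u from uw; iterating, L³ lies in every Lⁿ⁺³ + Z₂,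
  -- hence in Z₂ by nilpotency.
  have hle : ∀ n, A.pow 3 ≤ A.pow (n + 3) ⊔ A.upper 2 := by
    intro n
    induction n with
    | zero => exact le_sup_left
    | succ n ih =>
      intro u hu
      obtain ⟨v, hv, z, hz, rfl⟩ := Submodule.mem_sup.1 (ih hu)
      rw [← Submodule.smul_mem_iff _ ht0]
      have h1 := hsc _ hu
      have h2 : A.mul z w ∈ A.upper 2 :=
        A.center_le_upper_two (by rw [center_eq_upper]; exact A.mem_upper_succ.1 hz w)
      refine Submodule.mem_sup.2 ⟨A.mul v w, A.mul_mem_pow hv w, A.mul z w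
        - (A.mul (v + z) w - t • (v + z)), Submodule.sub_mem _ h2 h1, ?_⟩
      rw [map_add, LinearMap.add_apply]
      abel
  obtain ⟨m, hm⟩ := h.isNilpotent
  have hm3 : A.pow (m + 3) = ⊥ := by
    cases m with
    | zero => exact eq_bot_mono le_top hm
    | succ m => exact eq_bot_mono (A.pow_antitone (by omega)) hm
  have := hle m hp
  rw [hm3, bot_sup_eq] at this
  exact hpz this

theorem pow_four_le_upper_two (h : A.IsCenterThree) : A.pow 4 ≤ A.upper 2 :=
  Submodule.map₂_le.2 fun _ hu w _ => h.mul_mem_upper_two hu w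

theorem pow_five_le_center (h : A.IsCenterThree) : A.pow 5 ≤ A.center := by
  rw [center_eq_upper]
  exact Submodule.map₂_le.2 fun u hu w _ => A.mem_upper_succ.1 (h.pow_four_le_upper_two hu) w

/-- (uv, w) = (vw, u), where vw ∈ Z₂ is orthogonal to L³. Consequently y₂ may be altered by elements
of L³ without changing its products with L³. -/
theorem mul_eq_zero_of_mem_pow_three (h : A.IsCenterThree) {u v : L} (hu : u ∈ A.pow 3)
    (hv : v ∈ A.pow 3) : A.mul u v = 0 := by
  refine A.eq_zero_of_form fun w => ?_
  rw [A.cyclic]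
  exact A.form_eq_zero_of_mem_upper_two (h.mul_mem_upper_two hv w) hu

end IsCenterThree

end Flag

/-! ### From a hyperbolic system to a presentation. -/

section StandardBasis

variable {F L : Type*} [Field F] [AddCommGroup L] [Module F L]

theorem exists_basis_eq (A : SAA F L) {n : ℕ} [Nonempty (Fin n)]
    (hd : Module.finrank F L = n + n) (w : Fin n ⊕ Fin n → L) (hx : ∀ i j, A.form (w (.inl i)) (w (.inl j)) = 0)
    (hy : ∀ i j, A.form (w (.inr i)) (w (.inr j)) = 0)
    (hxy : ∀ i j, A.form (w (.inl i)) (w (.inr j)) = if i = j then 1 else 0) :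
    ∃ b : Module.Basis (Fin n ⊕ Fin n) F L, ⇑b = w ∧ A.IsStandardBasis b := by
  have hli : LinearIndependent F w := by
    rw [Fintype.linearIndependent_iff]
    intro g hg i
    rw [Fintype.sum_sum_type] at hg
    rcases i with i | i
    · have := congrArg (fun v => A.form v (w (.inr i))) hg
      simpa [hxy, hy] using this
    · have := congrArg (fun v => A.form (w (.inl i)) v) hg
      simpa [hxy, hx] using this
  let b := basisOfLinearIndependentOfCardEqFinrank hli (by simp [hd])
  have hb : ⇑b = w := coe_basisOfLinearIndependentOfCardEqFinrank hli _
  exact ⟨b, hb, by simp [hb, hx], by simp [hb, hy], by simp [hb, hxy]⟩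

/-- Reduces the presentation to the hypotheses produced by the normalization: triples through the
central x₃, x₄, x₅ vanish, and the rest follow from the listed products or from the values on y₄,
y₅. -/
theorem hasPresentation39_of_mul [CharP F 2] (A : SAA F L) (hd : Module.finrank F L = 10)
    {γ r s : F}
    (x y : Fin 5 → L) (hx : ∀ i j, A.form (x i) (x j) = 0) (hy : ∀ i j, A.form (y i) (y j) = 0)
    (hxy : ∀ i j, A.form (x i) (y j) = if i = j then 1 else 0)
    (hc : ∀ z, A.mul (x 2) z = 0 ∧ A.mul (x 3) z = 0 ∧ A.mul (x 4) z = 0)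
    (hx2 : A.mul (x 0) (x 1) = 0 ∧ A.mul (x 1) (y 0) = 0 ∧ A.mul (x 1) (y 1) = 0 ∧
      A.mul (x 1) (y 2) = 0)
    (h1 : A.mul (x 0) (y 0) = 0) (h2 : A.mul (x 0) (y 1) = x 3)
    (h3 : A.mul (x 0) (y 2) = r • x 3 + s • x 4) (h4 : A.mul (y 0) (y 1) = x 4)
    (h5 : A.mul (y 0) (y 2) = x 3) (h6 : A.mul (y 1) (y 2) = 0)
    (h7 : A.form (A.mul (x 1) (y 3)) (y 4) = γ) (h8 : A.form (A.mul (x 0) (y 3)) (y 4) = 0)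
    (h9 : ∀ i : Fin 3, A.form (A.mul (y (i.castLE (by omega))) (y 3)) (y 4) = 0) :
    A.HasPresentation (presentation39 γ r s) := by
  obtain ⟨b, hb, hs⟩ := A.exists_basis_eq hd (Sum.elim x y) hx hy hxy
  refine ⟨b, hs, ?_⟩
  have hc' : ∀ z, A.mul z (x 2) = 0 ∧ A.mul z (x 3) = 0 ∧ A.mul z (x 4) = 0 := fun z => by
    rw [A.mul_comm z, A.mul_comm z, A.mul_comm z]; exact hc z
  have h90 := h9 0
  have h91 := h9 1
  have h92 := h9 2
  simp [Fin.castLE] at h90 h91 h92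
  obtain ⟨hx20, hx21, hx22, hx23⟩ := hx2
  rw [hb]
  rintro (i | i) (j | j) (k | k) hij hjk
  all_goals try exact absurd hij Sum.Lex.not_inr_lt_inl
  all_goals try exact absurd hjk Sum.Lex.not_inr_lt_inl
  all_goals simp only [Sum.Lex.inl_lt_inl_iff, Sum.Lex.inr_lt_inr_iff] at hij hjk
  all_goals
    fin_cases i <;> fin_cases j <;> first
    | exact absurd hij (by decide)
    | (fin_cases k <;> first
        | exact absurd hjk (by decide)
        | simp [presentation39, *])

end StandardBasis

/-! ### Completing the basis by y₄ and y₅. -/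

section Normalization

variable {F L : Type*} [Field F] [AddCommGroup L] [Module F L]

theorem IsCenterThree.exists_form_eq_one {A : SAA F L} (h : A.IsCenterThree) {P : Submodule F L}
    {x : L} (hx : x ∉ P) : ∃ y, (∀ p ∈ P, A.form p y = 0) ∧ A.form x y = 1 := by
  rw [← h.orthogonal_orthogonal P, mem_orthogonal] at hx
  push Not at hx
  obtain ⟨y, hy, hxy⟩ := hx
  exact ⟨(A.form x y)⁻¹ • y, fun p hp => by simp [hy p hp], by simp [hxy]⟩

theorem IsCenterThree.exists_dual_pair {A : SAA F L} (h : A.IsCenterThree) {x x' : L}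
    (hi : ∀ a b : F, a • x + b • x' = 0 → a = 0 ∧ b = 0) :
    ∃ y y', A.form x y = 1 ∧ A.form x' y = 0 ∧ A.form x y' = 0 ∧ A.form x' y' = 1 := by
  have h1 : x ∉ Submodule.span F {x'} := fun hm => by
    obtain ⟨c, hc⟩ := Submodule.mem_span_singleton.1 hm
    exact one_ne_zero (hi 1 (-c) (by rw [← hc]; simp)).1
  have h2 : x' ∉ Submodule.span F {x} := fun hm => by
    obtain ⟨c, hc⟩ := Submodule.mem_span_singleton.1 hm
    exact one_ne_zero (hi (-c) 1 (by rw [← hc]; simp)).2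
  obtain ⟨y, hy, hxy⟩ := h.exists_form_eq_one h1
  obtain ⟨y', hy', hxy'⟩ := h.exists_form_eq_one h2
  exact ⟨y, y', hxy, hy _ (Submodule.mem_span_singleton_self _),
    hy' _ (Submodule.mem_span_singleton_self _), hxy'⟩

variable [CharP F 2]

set_option maxHeartbeats 400000 in
/-- A hyperbolic system `x₁, y₁, x₂, y₂, x₃, y₃` with the right products can be completed to a
standard basis by dual vectors of `x₄ = x₁y₂` and `x₅ = y₁y₂`. -/
theorem IsCenterThree.exists_presentation_of_hyperbolic {A : SAA F L} (h : A.IsCenterThree)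
    {r s : F} (hs : s ≠ 0) {x₁ x₂ x₃ x₄ x₅ y₁ y₂ y₃ : L}
    (h3 : A.mul x₃ = 0) (h4 : A.mul x₄ = 0) (h5 : A.mul x₅ = 0)
    (hi : ∀ a b : F, a • x₄ + b • x₅ = 0 → a = 0 ∧ b = 0)
    (o4 : A.form x₄ x₁ = 0 ∧ A.form x₄ x₂ = 0 ∧ A.form x₄ x₃ = 0 ∧ A.form x₄ x₅ = 0 ∧
      A.form x₄ y₁ = 0 ∧ A.form x₄ y₂ = 0 ∧ A.form x₄ y₃ = 0)
    (o5 : A.form x₅ x₁ = 0 ∧ A.form x₅ x₂ = 0 ∧ A.form x₅ x₃ = 0 ∧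
      A.form x₅ y₁ = 0 ∧ A.form x₅ y₂ = 0 ∧ A.form x₅ y₃ = 0)
    (o1 : A.form x₁ x₂ = 0 ∧ A.form x₁ x₃ = 0 ∧ A.form x₁ y₁ = 1 ∧ A.form x₁ y₂ = 0 ∧
      A.form x₁ y₃ = 0)
    (o2 : A.form x₂ x₃ = 0 ∧ A.form x₂ y₁ = 0 ∧ A.form x₂ y₂ = 1 ∧ A.form x₂ y₃ = 0)
    (o3 : A.form x₃ y₁ = 0 ∧ A.form x₃ y₂ = 0 ∧ A.form x₃ y₃ = 1)
    (oy : A.form y₁ y₂ = 0 ∧ A.form y₁ y₃ = 0 ∧ A.form y₂ y₃ = 0)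
    (m12 : A.mul x₁ x₂ = 0) (m1 : A.mul x₁ y₁ = 0) (m2 : A.mul x₁ y₂ = x₄)
    (m3 : A.mul x₁ y₃ = r • x₄ + s • x₅)
    (m21 : A.mul x₂ y₁ = 0) (m22 : A.mul x₂ y₂ = 0) (m23 : A.mul x₂ y₃ = 0)
    (n2 : A.mul y₁ y₂ = x₅) (n3 : A.mul y₁ y₃ = x₄) (n23 : A.mul y₂ y₃ = 0) :
    ∃ y₄ y₅, A.form x₄ y₄ = 1 ∧ A.form x₅ y₄ = 0 ∧ A.form x₄ y₅ = 0 ∧ A.form x₅ y₅ = 1 ∧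
      A.HasPresentation (presentation39 (A.form (A.mul x₂ y₄) y₅) r s) := by
  obtain ⟨o41, o42, o43, o45, o46, o47, o48⟩ := o4
  obtain ⟨o51, o52, o53, o56, o57, o58⟩ := o5
  obtain ⟨o12, o13, o16, o17, o18⟩ := o1
  obtain ⟨o23, o26, o27, o28⟩ := o2
  obtain ⟨o36, o37, o38⟩ := o3
  obtain ⟨o67, o68, o78⟩ := oy
  have h2 : (2 : F) = 0 := CharTwo.two_eq_zero
  have hadd : ∀ x : F, x + x = 0 := CharTwo.add_self_eq_zero
  have o54 : A.form x₅ x₄ = 0 := by rw [A.form_comm, o45]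
  have h3' : ∀ z, A.mul z x₃ = 0 := fun z => by rw [A.mul_comm, h3]; rfl
  have h4' : ∀ z, A.mul z x₄ = 0 := fun z => by rw [A.mul_comm, h4]; rfl
  have h5' : ∀ z, A.mul z x₅ = 0 := fun z => by rw [A.mul_comm, h5]; rfl
  have m2' : A.mul y₂ x₁ = x₄ := by rw [A.mul_comm, m2]
  have m3' : A.mul y₃ x₁ = r • x₄ + s • x₅ := by rw [A.mul_comm, m3]
  have n2' : A.mul y₂ y₁ = x₅ := by rw [A.mul_comm, n2]
  have n3' : A.mul y₃ y₁ = x₄ := by rw [A.mul_comm, n3]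
  have n23' : A.mul y₃ y₂ = 0 := by rw [A.mul_comm, n23]
  have m1' : A.mul y₁ x₁ = 0 := by rw [A.mul_comm, m1]
  obtain ⟨z₄, y₅, d44, d54, d45, d55⟩ := h.exists_dual_pair hi
  -- The correction kills (vw₄, y₅) for v = x₁, y₁, y₂, y₃ independently: y₁ and y₂ are matched by
  -- (y₁y₂, y₅) = 1, x₁ and y₃ by (x₁y₃, y₅) = s, and the other pairs contribute 0.
  obtain ⟨w₄, hw₄⟩ : ∃ w, w = z₄ + A.form (A.mul y₁ z₄) y₅ • y₂
      + (A.form (A.mul x₁ z₄) y₅ / s) • y₃ + A.form (A.mul y₂ z₄) y₅ • y₁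
      + (A.form (A.mul y₃ z₄) y₅ / s) • x₁ := ⟨_, rfl⟩
  have e44 : A.form x₄ w₄ = 1 := by simp [hw₄, d44, o41, o46, o47, o48]
  have e54 : A.form x₅ w₄ = 0 := by simp [hw₄, d54, o51, o56, o57, o58]
  have t1 : A.form (A.mul x₁ w₄) y₅ = 0 := by
    simp [hw₄, m2, m3, m1, A.mul_alt, d45, d55, hs, hadd]
  have t2 : A.form (A.mul y₁ w₄) y₅ = 0 := by
    simp [hw₄, n2, n3, m1', A.mul_alt, d45, d55, hadd]
  have t3 : A.form (A.mul y₂ w₄) y₅ = 0 := by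
    simp [hw₄, n23, n2', m2', A.mul_alt, d45, d55, hadd]
  have t4 : A.form (A.mul y₃ w₄) y₅ = 0 := by
    simp [hw₄, n23', n3', m3', A.mul_alt, d45, d55, hs, hadd]
  obtain ⟨y₄, hy₄⟩ : ∃ y, y = w₄ + A.form w₄ y₅ • x₅ := ⟨_, rfl⟩
  have f44 : A.form x₄ y₄ = 1 := by simp [hy₄, e44, o45]
  have f54 : A.form x₅ y₄ = 0 := by simp [hy₄, e54, A.form_alt]
  have f45 : A.form y₄ y₅ = 0 := by simp [hy₄, d55, hadd]
  have hm4 : ∀ z, A.mul z y₄ = A.mul z w₄ := fun z => by simp [hy₄, h5']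
  rw [← hm4] at t1 t2 t3 t4
  have f44' : A.form y₄ x₄ = 1 := by rw [A.form_comm, f44]
  have f54' : A.form y₄ x₅ = 0 := by rw [A.form_comm, f54]
  have d45' : A.form y₅ x₄ = 0 := by rw [A.form_comm, d45]
  have d55' : A.form y₅ x₅ = 1 := by rw [A.form_comm, d55]
  refine ⟨y₄, y₅, f44, f54, d45, d55, ?_⟩
  -- p makes a vector orthogonal to y₄ and y₅ by adding multiples of x₄ and x₅; these are central,
  -- so products are unaffected.
  obtain ⟨p, hp⟩ : ∃ p : L → L, ∀ v, p v = v + A.form v y₄ • x₄ + A.form v y₅ • x₅ :=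
    ⟨_, fun _ => rfl⟩
  have hmp : ∀ v w, A.mul (p v) (p w) = A.mul v w := fun v w => by simp [hp, h4, h5, h4', h5']
  have hmp4 : ∀ v, A.mul (p v) y₄ = A.mul v y₄ := fun v => by simp [hp, h4, h5]
  have hp4 : ∀ v, A.form (p v) y₄ = 0 := fun v => by simp [hp, f44, f54, hadd]
  have hp5 : ∀ v, A.form (p v) y₅ = 0 := fun v => by simp [hp, d45, d55, hadd]
  have hpp : ∀ v w, A.form x₄ v = 0 → A.form x₅ v = 0 → A.form x₄ w = 0 → A.form x₅ w = 0 →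
      A.form (p v) (p w) = A.form v w := fun v w a1 a2 a3 a4 => by
    simp [hp, A.form_alt, a1, a2, a3, a4, A.form_comm v x₄, A.form_comm v x₅, o45, o54]
  have hpx : ∀ v, A.form x₄ v = 0 → A.form x₅ v = 0 → A.form x₄ (p v) = 0 ∧ A.form x₅ (p v) = 0 :=
    fun v a1 a2 => by simp [hp, A.form_alt, a1, a2, o45, o54]
  have hpx' : ∀ v, A.form x₄ v = 0 → A.form x₅ v = 0 → A.form (p v) x₄ = 0 ∧ A.form (p v) x₅ = 0 :=
    fun v a1 a2 => by rw [A.form_comm, A.form_comm (p v)]; exact hpx v a1 a2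
  have hp3 : A.mul (p x₃) = 0 := by simp [hp, h3, h4, h5]
  have o21 : A.form x₂ x₁ = 0 := by rw [A.form_comm, o12]
  have o31 : A.form x₃ x₁ = 0 := by rw [A.form_comm, o13]
  have o32 : A.form x₃ x₂ = 0 := by rw [A.form_comm, o23]
  have o76 : A.form y₂ y₁ = 0 := by rw [A.form_comm, o67]
  have o86 : A.form y₃ y₁ = 0 := by rw [A.form_comm, o68]
  have o87 : A.form y₃ y₂ = 0 := by rw [A.form_comm, o78]
  have g54 : A.form y₅ y₄ = 0 := by rw [A.form_comm, f45]
  have hp4' : ∀ v, A.form y₄ (p v) = 0 := fun v => by rw [A.form_comm, hp4]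
  have hp5' : ∀ v, A.form y₅ (p v) = 0 := fun v => by rw [A.form_comm, hp5]
  refine A.hasPresentation39_of_mul h.finrank_eq ![p x₁, p x₂, p x₃, x₄, x₅]
    ![p y₁, p y₂, p y₃, y₄, y₅] ?_ ?_ ?_ ?_ ?_ ?_ ?_ ?_ ?_ ?_ ?_ ?_ ?_ ?_
  · intro i j
    fin_cases i <;> fin_cases j <;>
      simp [A.form_alt, hpp, hpx, hpx', o41, o42, o43, o45, o51, o52, o53, o54, o12, o13, o23, o21,
        o31, o32]
  · intro i j
    fin_cases i <;> fin_cases j <;>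
      simp [A.form_alt, hpp, hp4, hp5, hp4', hp5', f45, g54, o46, o47, o48, o56, o57, o58, o67, o68,
        o76, o78, o86, o87]
  · intro i j
    fin_cases i <;> fin_cases j <;>
      simp [hpp, hpx, hp4, hp5, f44, f54, d45, d55, o41, o42, o43, o46, o47, o48, o51, o52, o53,
        o56, o57, o58, o16, o17, o18, o26, o27, o28, o36, o37, o38]
  · intro z
    simp [hp3, h4, h5]
  · simp [hmp, m12, m21, m22, m23]
  · simp [hmp, m1]
  · simp [hmp, m2]
  · simp [hmp, m3]
  · simp [hmp, n2]
  · simp [hmp, n3]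
  · simp [hmp, n23]
  · simp [hmp4]
  · simp [hmp4, t1]
  · simp [Fin.forall_fin_succ, Fin.castLE, hmp4, t2, t3, t4]

end Normalization

/-! ### Normalizing x₁, x₂, x₃, y₁, y₂, y₃, and non-vanishing of γ. -/

section Normalization

variable {F L : Type*} [Field F] [AddCommGroup L] [Module F L] [CharP F 2]

/-- Starting from `x₁, y₁ ∈ L³`, `y₂ ∈ L²` and `y₃ ∈ Z₄(L)` with the right products modulo lower
terms, one reaches the presentation `𝒫₁₀^{(3,9)}(γ, r, s)`. -/
theorem IsCenterThree.exists_presentation {A : SAA F L} (h : A.IsCenterThree)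
    {r s : F} (hs : s ≠ 0) {x₁ y₁ y₂ y₃ : L} (hx₁ : x₁ ∈ A.pow 3) (hy₁ : y₁ ∈ A.pow 3)
    (hxy : A.form x₁ y₁ = 1) (hy₂ : y₂ ∈ A.pow 2) (hy₂' : y₂ ∉ A.pow 3) (hy₃ : y₃ ∈ A.upper 4)
    (hy₃' : y₃ ∉ A.pow 2)
    (hx : A.mul x₁ y₃ = r • A.mul x₁ y₂ + s • A.mul y₁ y₂) (hy : A.mul y₁ y₃ = A.mul x₁ y₂)
    (hZ : ∀ z ∈ A.upper 2, A.mul z y₃ = 0)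
    (hi : ∀ a b : F, a • A.mul x₁ y₂ + b • A.mul y₁ y₂ = 0 → a = 0 ∧ b = 0)
    (hE : A.pow 5 = Submodule.span F {A.mul x₁ y₂, A.mul y₁ y₂}) :
    ∃ γ, γ ≠ 0 ∧ A.HasPresentation (presentation39 γ r s) := by
  have := h.finiteDimensional
  have hadd : ∀ x : F, x + x = 0 := CharTwo.add_self_eq_zero
  have horth : A.pow 5 = A.form.orthogonal (A.upper 4) := h.pow_eq_orthogonal 4
  have horth' : A.upper 4 = A.form.orthogonal (A.pow 5) := A.upper_eq_orthogonal 4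
  have hP24 : A.pow 2 ≤ A.upper 4 := by
    rw [horth', h.pow_eq_orthogonal 1, ← center_eq_upper]
    exact LinearMap.BilinForm.orthogonal_le h.pow_five_le_center
  have hx₄ : A.mul x₁ y₂ ∈ A.pow 5 := by rw [hE]; exact Submodule.subset_span (by simp)
  have hx₅ : A.mul y₁ y₂ ∈ A.pow 5 := by rw [hE]; exact Submodule.subset_span (by simp)
  have hd5 : Module.finrank F (A.pow 5) = 2 := by
    have hli : LinearIndependent F ![A.mul x₁ y₂, A.mul y₁ y₂] := by
      rw [LinearIndependent.pair_iff]
      exact hi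
    rw [hE, ← Matrix.range_cons_cons_empty _ _ ![], finrank_span_eq_card hli]
    simp
  have hd4 : Module.finrank F (A.upper 4) = Module.finrank F (A.pow 2) + 1 := by
    rw [horth', h.finrank_orthogonal, hd5, h.finrank_pow_two]
  have hdec : ∀ v ∈ A.upper 4, ∃ p ∈ A.pow 3, ∃ a b : F, v = p + a • y₂ + b • y₃ := by
    intro v hv
    obtain ⟨q, hq, b, rfl⟩ := exists_eq_add_smul hP24 hd4 hy₃ hy₃' hv
    obtain ⟨p, hp, a, rfl⟩ := exists_eq_add_smul (A.pow_succ_le 1)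
      (by rw [h.finrank_pow_two, h.finrank_pow_three]) hy₂ hy₂' hq
    exact ⟨p, hp, a, b, rfl⟩
  have ho : ∀ e ∈ A.pow 5, ∀ v ∈ A.upper 4, A.form e v = 0 := fun e he => by
    rw [horth, mem_orthogonal] at he
    exact he
  have hdec3 : ∀ u ∈ A.pow 3, ∃ z ∈ A.upper 2, ∃ a b : F, u = z + a • x₁ + b • y₁ := by
    intro u hu
    refine exists_eq_add_smul_add_smul h.upper_two_le_pow_three
      (by rw [h.finrank_upper_two, h.finrank_pow_three]) hx₁ hy₁ (fun a b hab => ?_) hu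
    have := A.mul_eq_zero_of_mem_upper_two hab hy₂
    exact hi a b (by simpa using this)
  have hmul2 : ∀ u ∈ A.pow 3, A.mul u y₂ ∈ A.pow 5 := by
    intro u hu
    obtain ⟨z, hz, a, b, rfl⟩ := hdec3 u hu
    simpa [A.mul_eq_zero_of_mem_upper_two hz hy₂] using
      add_mem (Submodule.smul_mem _ a hx₄) (Submodule.smul_mem _ b hx₅)
  -- L⁵ is the complement of Z₄ = L³ + ⟨y₂, y₃⟩. For p ∈ L³, (y₂y₃, p) = (py₂, y₃) = 0 since py₂ ∈
  -- L⁵.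
  have h23 : A.mul y₂ y₃ ∈ A.pow 5 := by
    rw [horth, mem_orthogonal]
    intro v hv
    obtain ⟨p, hp, a, b, rfl⟩ := hdec v hv
    have : A.form (A.mul y₂ y₃) p = 0 := by
      rw [A.form_mul_right_comm, A.mul_comm]
      exact ho _ (hmul2 p hp) _ hy₃
    simp [this, A.form_mul_self, A.form_mul_self']
  rw [hE, Submodule.mem_span_pair] at h23
  obtain ⟨a, b, h23⟩ := h23
  obtain ⟨x₄, hx₄e⟩ : ∃ x, x = A.mul x₁ y₂ := ⟨_, rfl⟩
  obtain ⟨x₅, hx₅e⟩ : ∃ x, x = A.mul y₁ y₂ := ⟨_, rfl⟩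
  rw [← hx₄e, ← hx₅e] at hx h23 hE hi
  rw [← hx₄e] at hy hx₄
  rw [← hx₅e] at hx₅
  have c4 : A.mul x₄ = 0 := h.pow_five_le_center hx₄
  have c5 : A.mul x₅ = 0 := h.pow_five_le_center hx₅
  -- The added element v of L³ solves vy₃ = ax₄ + bx₅ = y₂y₃, so that w₂y₃ = 0 in characteristic 2.
  obtain ⟨w₂, hw₂⟩ : ∃ w, w = y₂ + ((b / s) • x₁ + (a - r * b / s) • y₁) := ⟨_, rfl⟩
  have hv₃ : (b / s) • x₁ + (a - r * b / s) • y₁ ∈ A.pow 3 :=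
    add_mem (Submodule.smul_mem _ _ hx₁) (Submodule.smul_mem _ _ hy₁)
  have hw₂P : w₂ ∈ A.pow 2 := by
    rw [hw₂]; exact add_mem hy₂ (A.pow_succ_le 1 hv₃)
  have hw₂P' : w₂ ∉ A.pow 3 := by
    rw [hw₂, Submodule.add_mem_iff_left _ hv₃]; exact hy₂'
  have hw₂m : ∀ u ∈ A.pow 3, A.mul u w₂ = A.mul u y₂ := fun u hu => by
    rw [hw₂, map_add, h.mul_eq_zero_of_mem_pow_three hu hv₃, add_zero]
  have hw₂₃ : A.mul w₂ y₃ = 0 := by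
    have e : A.mul w₂ y₃ = (a + a) • x₄ + (b + b) • x₅ := by
      simp only [hw₂, map_add, map_smul, LinearMap.add_apply, LinearMap.smul_apply, hx, hy, ← h23]
      match_scalars <;> field_simp
      ring
    rw [e, hadd, hadd]; simp
  obtain ⟨x₃, hx₃o, hx₃y⟩ := h.exists_form_eq_one hy₃'
  have hx₃ : x₃ ∈ A.center := by
    rw [center_eq_upper, upper_eq_orthogonal]; exact hx₃o
  have c3 : A.mul x₃ = 0 := hx₃
  have c3' : ∀ z, A.mul z x₃ = 0 := fun z => by rw [A.mul_comm, c3]; rfl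
  have hx₃y' : A.form x₃ y₃ = 1 := by rw [A.form_comm, hx₃y]
  obtain ⟨v₂, hv₂o, hv₂y⟩ := h.exists_form_eq_one hw₂P'
  have hv₂ : v₂ ∈ A.upper 2 := by rw [upper_eq_orthogonal]; exact hv₂o
  obtain ⟨x₂, hx₂e⟩ : ∃ x, x = v₂ + A.form v₂ y₃ • x₃ := ⟨_, rfl⟩
  have hx₂ : x₂ ∈ A.upper 2 := by
    rw [hx₂e]; exact add_mem hv₂ (Submodule.smul_mem _ _ (A.center_le_upper_two hx₃))
  have o23' : A.form x₂ y₃ = 0 := by simp [hx₂e, hx₃y', hadd]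
  obtain ⟨u₂, hu₂⟩ : ∃ u, u = w₂ + A.form w₂ y₃ • x₃ := ⟨_, rfl⟩
  have hu₂P : u₂ ∈ A.pow 2 := by
    rw [hu₂]; exact add_mem hw₂P (Submodule.smul_mem _ _ (h.center_le_pow_two hx₃))
  have hu₂m : ∀ u, A.mul u u₂ = A.mul u w₂ := fun u => by simp [hu₂, c3']
  have hu₂₃ : A.mul u₂ y₃ = 0 := by simp [hu₂, c3, hw₂₃]
  have oy23 : A.form u₂ y₃ = 0 := by simp [hu₂, hx₃y', hadd]
  have oz : ∀ v ∈ A.pow 2, A.form x₃ v = 0 := fun v hv => A.form_eq_zero_of_mem_center hx₃ hv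
  have oz2 : ∀ v ∈ A.pow 3, A.form x₂ v = 0 := fun v hv => A.form_eq_zero_of_mem_upper_two hx₂ hv
  have o22 : A.form x₂ u₂ = 1 := by
    have e1 : A.form x₂ x₃ = 0 := oz2 _ (h.center_le_pow_three hx₃)
    rw [hu₂, map_add, map_smul, e1, hx₂e, map_add, LinearMap.add_apply, A.form_comm v₂, hv₂y,
      map_smul, LinearMap.smul_apply, oz w₂ hw₂P]
    simp
  -- For v ∈ L³, p makes v orthogonal to u₂ and y₃ by terms in Z₂, which kill both u₂ and y₃.
  obtain ⟨p, hp⟩ : ∃ p : L → L, ∀ v, p v = v + A.form v u₂ • x₂ + A.form v y₃ • x₃ :=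
    ⟨_, fun _ => rfl⟩
  have hp3 : ∀ v ∈ A.pow 3, p v ∈ A.pow 3 := fun v hv => by
    rw [hp]
    exact add_mem (add_mem hv (Submodule.smul_mem _ _ (h.upper_two_le_pow_three hx₂)))
      (Submodule.smul_mem _ _ (h.center_le_pow_three hx₃))
  have hpo2 : ∀ v, A.form (p v) u₂ = 0 := fun v => by simp [hp, o22, oz u₂ hu₂P, hadd]
  have hpo3 : ∀ v, A.form (p v) y₃ = 0 := fun v => by simp [hp, o23', hx₃y', hadd]
  have hpm2 : ∀ v ∈ A.pow 3, A.mul (p v) u₂ = A.mul v y₂ := fun v hv => by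
    rw [← hw₂m v hv, ← hu₂m v]
    simp [hp, c3, A.mul_eq_zero_of_mem_upper_two hx₂ hu₂P]
  have hpm3 : ∀ v, A.mul (p v) y₃ = A.mul v y₃ := fun v => by simp [hp, c3, hZ x₂ hx₂]
  have hpxy : A.form (p x₁) (p y₁) = 1 := by
    have e1 := oz2 y₁ hy₁
    have e2 := oz y₁ (A.pow_succ_le 1 hy₁)
    have e3 := oz2 _ (hp3 x₁ hx₁)
    have e4 := oz _ (A.pow_succ_le 1 (hp3 x₁ hx₁))
    rw [A.form_comm] at e3 e4
    rw [hp y₁]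
    simp only [map_add, map_smul, e3, e4]
    simp [hp, e1, e2, hxy]
  have hp34 : A.pow 3 ≤ A.upper 4 := (A.pow_succ_le 1).trans hP24
  have o3P := fun v hv => A.form_comm x₃ v ▸ oz v hv
  obtain ⟨y₄, y₅, d44, d54, d45, d55, hpres⟩ := h.exists_presentation_of_hyperbolic (r := r) hs
    (x₁ := p x₁) (y₁ := p y₁) (x₂ := x₂) (x₃ := x₃) (x₄ := x₄) (x₅ := x₅) (y₂ := u₂) (y₃ := y₃)
    c3 c4 c5 hi
    ⟨ho _ hx₄ _ (hp34 (hp3 _ hx₁)), ho _ hx₄ _ (hp34 (h.upper_two_le_pow_three hx₂)),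
      ho _ hx₄ _ (hP24 (h.center_le_pow_two hx₃)),
      ho _ hx₄ _ (hP24 (h.center_le_pow_two (h.pow_five_le_center hx₅))),
      ho _ hx₄ _ (hp34 (hp3 _ hy₁)), ho _ hx₄ _ (hP24 hu₂P), ho _ hx₄ _ hy₃⟩
    ⟨ho _ hx₅ _ (hp34 (hp3 _ hx₁)), ho _ hx₅ _ (hp34 (h.upper_two_le_pow_three hx₂)),
      ho _ hx₅ _ (hP24 (h.center_le_pow_two hx₃)),
      ho _ hx₅ _ (hp34 (hp3 _ hy₁)), ho _ hx₅ _ (hP24 hu₂P), ho _ hx₅ _ hy₃⟩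
    ⟨by rw [A.form_comm]; exact oz2 _ (hp3 _ hx₁),
      by rw [A.form_comm]; exact oz _ (A.pow_succ_le 1 (hp3 _ hx₁)), hpxy, hpo2 _, hpo3 _⟩
    ⟨oz2 _ (h.center_le_pow_three hx₃), oz2 _ (hp3 _ hy₁), o22, o23'⟩
    ⟨oz _ (A.pow_succ_le 1 (hp3 _ hy₁)), oz _ hu₂P, hx₃y'⟩
    ⟨hpo2 _, hpo3 _, oy23⟩
    (h.mul_eq_zero_of_mem_pow_three (hp3 _ hx₁) (h.upper_two_le_pow_three hx₂))
    (h.mul_eq_zero_of_mem_pow_three (hp3 _ hx₁) (hp3 _ hy₁))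
    (by rw [hpm2 _ hx₁, hx₄e]) (by rw [hpm3, hx])
    (h.mul_eq_zero_of_mem_pow_three (h.upper_two_le_pow_three hx₂) (hp3 _ hy₁))
    (A.mul_eq_zero_of_mem_upper_two hx₂ hu₂P) (hZ _ hx₂)
    (by rw [hpm2 _ hy₁, hx₅e]) (by rw [hpm3, hy]) hu₂₃
  -- x₂ annihilates Z₄, and L = Z₄ + ⟨y₄, y₅⟩. So γ = 0 would make x₂ central, hence orthogonal to
  -- u₂ ∈ L², against (x₂, u₂) = 1.
  refine ⟨_, fun hγ => ?_, hpres⟩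
  have hx₂4 : ∀ v ∈ A.upper 4, A.mul x₂ v = 0 := by
    intro v hv
    obtain ⟨q, hq, a, b, rfl⟩ := hdec v hv
    simp [h.mul_eq_zero_of_mem_pow_three (h.upper_two_le_pow_three hx₂) hq,
      A.mul_eq_zero_of_mem_upper_two hx₂ hy₂, hZ x₂ hx₂]
  have hdecL : ∀ v, ∃ q ∈ A.upper 4, ∃ a b : F, v = q + a • y₄ + b • y₅ := by
    intro v
    refine ⟨v - A.form x₄ v • y₄ - A.form x₅ v • y₅, ?_, A.form x₄ v, A.form x₅ v, by abel⟩
    rw [horth', hE, LinearMap.BilinForm.mem_orthogonal_iff]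
    intro e he
    obtain ⟨a, b, rfl⟩ := Submodule.mem_span_pair.1 he
    simp [d44, d45, d54, d55]
  have hx₂0 : x₂ ∈ A.center := by
    refine LinearMap.ext fun v => A.eq_zero_of_form fun w => ?_
    obtain ⟨q, hq, a, b, rfl⟩ := hdecL v
    obtain ⟨q', hq', a', b', rfl⟩ := hdecL w
    have e1 : ∀ y, A.form (A.mul x₂ y) q' = 0 := fun y => by
      rw [A.form_mul_right_comm, hx₂4 q' hq']; simp
    have e2 : A.form (A.mul x₂ y₅) y₄ = 0 := by rw [A.form_mul_right_comm, hγ]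
    simp [hx₂4 q hq, e1, e2, hγ, A.form_mul_self']
  have := A.form_eq_zero_of_mem_center hx₂0 hu₂P
  rw [o22] at this
  exact one_ne_zero this

end Normalization

/-! ### Extracting x₁, y₁ from the operator τ. -/

section Normalization

variable {F L : Type*} [Field F] [AddCommGroup L] [Module F L] [CharP F 2]

/-- x₅ = y₁y₂ is any nonzero vector of L⁵, and x₁ is chosen with x₁y₂ = y₁y₃ = τx₅. Then x₁y₃ = τ²x₅
= rx₄ + sx₅. -/
theorem IsCenterThree.exists_presentation_of_isTypeC {A : SAA F L} (h : A.IsCenterThree)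
    (h5 : A.prod (A.pow 3) (A.pow 2) = A.pow 5) (hA : A.IsTypeCWithLinearTerm) :
    ∃ γ r s : F, γ ≠ 0 ∧ r ≠ 0 ∧ Irreducible (X ^ 2 + C r * X + C s) ∧
      A.HasPresentation (presentation39 γ r s) := by
  have := h.finiteDimensional
  obtain ⟨y₂, hy₂, hy₂', y₃, hy₃, hy₃', τ, hτ, r, s, hr, hmin, hirr⟩ := hA
  have hroot := eval_ne_zero_of_irreducible hirr
  have hs := const_ne_zero_of_irreducible hirr
  have hsurj : ∀ x ∈ A.pow 5, ∃ u ∈ A.pow 3, A.mul u y₂ = x := by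
    have hle : A.pow 5 ≤ (A.pow 3).map (A.mul.flip y₂) := by
      rw [← h5]
      refine Submodule.map₂_le.2 fun u hu v hv => ?_
      obtain ⟨p, hp, c, rfl⟩ := exists_eq_add_smul (A.pow_succ_le 1)
        (by rw [h.finrank_pow_two, h.finrank_pow_three]) hy₂ hy₂' hv
      exact ⟨c • u, Submodule.smul_mem _ _ hu, by simp [h.mul_eq_zero_of_mem_pow_three hu hp]⟩
    intro x hx
    obtain ⟨u, hu, hux⟩ := hle hx
    exact ⟨u, hu, hux⟩
  have hpoly : ∀ w, τ (τ w) + r • τ w + s • w = 0 := by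
    have h0 := minpoly.aeval F τ
    rw [hmin] at h0
    intro w
    simpa [pow_two, Module.End.mul_apply, Module.algebraMap_end_apply] using
      congrArg (fun f => f w) h0
  have hnt : ∃ w : A.pow 5, w ≠ 0 := by
    by_contra hcon
    push Not at hcon
    have hsub : Subsingleton (A.pow 5) := ⟨fun a b => (hcon a).trans (hcon b).symm⟩
    have : minpoly F τ = 1 := minpoly.subsingleton F τ
    rw [← hmin, this] at hirr
    exact not_irreducible_one hirr
  obtain ⟨⟨w, hw⟩, hw0⟩ := hnt
  have hw0 : w ≠ 0 := fun h0 => hw0 (by simp [h0])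
  obtain ⟨y₁, hy₁, rfl⟩ := hsurj w hw
  obtain ⟨w₅, hw₅, hw₅'⟩ := hτ y₁ hy₁
  have hy₁₃ : A.mul y₁ y₃ ∈ A.pow 5 := by rw [← hw₅']; exact (τ w₅).2
  obtain ⟨x₁, hx₁, hx₁y⟩ := hsurj _ hy₁₃
  obtain ⟨w₄, hw₄, hw₄'⟩ := hτ x₁ hx₁
  have h45 : τ w₅ = w₄ := Subtype.ext (by rw [hw₅', hw₄, hx₁y])
  have hx₁₃ : A.mul x₁ y₃ = r • A.mul x₁ y₂ + s • A.mul y₁ y₂ := by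
    have e := congrArg (Subtype.val) (hpoly w₅)
    rw [h45] at e
    simp only [Submodule.coe_add, Submodule.coe_smul, hw₄', hw₄, hw₅, Submodule.coe_zero,
      add_assoc] at e
    rw [← neg_eq_of_charP_two F (A.mul x₁ y₃)]
    exact neg_eq_of_add_eq_zero_right e
  -- A dependence would make y₁y₂ an eigenvector of τ, and its eigenvalue a root of t² + rt + s.
  have hi : ∀ a b : F, a • A.mul x₁ y₂ + b • A.mul y₁ y₂ = 0 → a = 0 ∧ b = 0 := by
    intro a b hab
    by_cases ha : a = 0
    · subst ha
      simpa [hw0] using hab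
    exfalso
    have e1 : A.mul x₁ y₂ = (b / a) • A.mul y₁ y₂ := by
      rw [← neg_eq_of_charP_two F (_ • A.mul y₁ y₂), eq_neg_iff_add_eq_zero,
        ← smul_eq_zero_iff_right ha, ← hab, smul_add, smul_smul, mul_div_cancel₀ _ ha]
    have e2 : w₄ = (b / a) • w₅ := Subtype.ext (by rw [hw₄, e1, Submodule.coe_smul, hw₅])
    have e3 := hpoly w₅
    rw [h45, e2, map_smul, h45, e2, smul_smul, smul_smul, ← add_smul, ← add_smul] at e3
    rcases smul_eq_zero.1 e3 with e3 | e3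
    · exact hroot (b / a) (by linear_combination e3)
    · exact hw0 (by rw [← hw₅, e3]; rfl)
  -- τφ = ψ, and φ kills Z₂ because Z₂L² = 0; hence so does ψ.
  have hZ : ∀ z ∈ A.upper 2, A.mul z y₃ = 0 := by
    intro z hz
    obtain ⟨v, hv, hv'⟩ := hτ z (h.upper_two_le_pow_three hz)
    have : v = 0 := Subtype.ext (by rw [hv, A.mul_eq_zero_of_mem_upper_two hz hy₂]; rfl)
    rw [← hv', this, map_zero]; rfl
  have hdec3 : ∀ u ∈ A.pow 3, ∃ z ∈ A.upper 2, ∃ a b : F, u = z + a • x₁ + b • y₁ := by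
    intro u hu
    refine exists_eq_add_smul_add_smul h.upper_two_le_pow_three
      (by rw [h.finrank_upper_two, h.finrank_pow_three]) hx₁ hy₁ (fun a b hab => ?_) hu
    have := A.mul_eq_zero_of_mem_upper_two hab hy₂
    exact hi a b (by simpa using this)
  have hE : A.pow 5 = Submodule.span F {A.mul x₁ y₂, A.mul y₁ y₂} := by
    refine le_antisymm (fun x hx => ?_) (Submodule.span_le.2 ?_)
    · obtain ⟨u, hu, rfl⟩ := hsurj x hx
      obtain ⟨z, hz, a, b, rfl⟩ := hdec3 u hu
      exact Submodule.mem_span_pair.2 ⟨a, b, by simp [A.mul_eq_zero_of_mem_upper_two hz hy₂]⟩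
    · rintro x (rfl | rfl)
      · rw [hx₁y]; exact hy₁₃
      · exact hw
  obtain ⟨d, hd⟩ : ∃ d, d = A.form x₁ y₁ := ⟨_, rfl⟩
  have hd0 : d ≠ 0 := by
    rintro rfl
    have hx₁u : x₁ ∈ A.upper 2 := by
      rw [upper_eq_orthogonal, mem_orthogonal]
      intro v hv
      obtain ⟨z, hz, a, b, rfl⟩ := hdec3 v hv
      have e := A.form_eq_zero_of_mem_upper_two hz hx₁
      rw [A.form_comm] at e
      simp [e, A.form_alt, ← hd]
    have := hi 1 0 (by simp [A.mul_eq_zero_of_mem_upper_two hx₁u hy₂])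
    exact one_ne_zero this.1
  have hd' : d⁻¹ ≠ 0 := inv_ne_zero hd0
  -- Scaling x₁ by d⁻¹ makes (x₁, y₁) = 1. Scaling y₃ alike keeps y₁y₃ = x₁y₂ and replaces τ by τ/d,
  -- so r and s become r/d and s/d².
  obtain ⟨γ, hγ, hp⟩ := h.exists_presentation (r := r / d) (s := s / d ^ 2) (x₁ := d⁻¹ • x₁)
    (y₁ := y₁) (y₂ := y₂) (y₃ := d⁻¹ • y₃) (div_ne_zero hs (pow_ne_zero 2 hd0))
    (Submodule.smul_mem _ _ hx₁) hy₁ (by simp [← hd, hd0]) hy₂ hy₂' (Submodule.smul_mem _ _ hy₃)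
    (by rwa [Submodule.smul_mem_iff _ hd'])
    (by
      simp only [map_smul, LinearMap.smul_apply, hx₁₃]
      match_scalars <;> field_simp)
    (by simp [hx₁y])
    (fun z hz => by simp [hZ z hz])
    (fun a b hab => by
      have := hi (a * d⁻¹) b (by simpa [smul_smul] using hab)
      simpa [hd0] using this)
    (by
      rw [hE, map_smul, LinearMap.smul_apply, Submodule.span_insert, Submodule.span_insert,
        Submodule.span_singleton_smul_eq hd'.isUnit])
  refine ⟨γ, r / d, s / d ^ 2, hγ, div_ne_zero hr hd0, irreducible_of_eval_ne_zero fun x hx => ?_,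
    hp⟩
  refine hroot (d * x) ?_
  field_simp at hx
  linear_combination hx

end Normalization

end SAA

theorem proposition4p15 {F : Type*} [Field F] [CharP F 2] :
    (∀ (L : Type*) [AddCommGroup L] [Module F L] (A : SAA F L),
      Module.finrank F L = 10 → A.IsNilpotent →
      A.IsIsotropic A.center → Module.finrank F A.center = 3 →
      Module.finrank F (A.pow 3) = 6 → A.prod (A.pow 3) (A.pow 2) = A.pow 5 →
      A.IsTypeCWithLinearTerm →
      ∃ γ r s : F, γ ≠ 0 ∧ r ≠ 0 ∧ Irreducible (X ^ 2 + C r * X + C s) ∧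
        A.HasPresentation (presentation39 γ r s)) ∧
    (∀ γ r s γ' r' s' : F, γ ≠ 0 → r ≠ 0 → Irreducible (X ^ 2 + C r * X + C s) →
      γ' ≠ 0 → r' ≠ 0 → Irreducible (X ^ 2 + C r' * X + C s') →
      ((SAA.presented (presentation39 γ' r' s')).Isomorphic
          (SAA.presented (presentation39 γ r s)) ↔
        (∃ c : F, c ≠ 0 ∧ γ' / γ = c ^ 3) ∧ r' / r ∈ groupG r s ∧
          s' - (r' / r) ^ 2 * s ∈ groupH r')) := by
  refine ⟨fun L _ _ A hd hn hi hc h3 h5 hA => ?_, fun γ r s γ' r' s' hγ hr hirr hγ' hr' hirr' =>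
    ⟨fun h => ?_, fun ⟨h1, h2, h3⟩ => SAA.isomorphic_of_invariants hγ hr hr' h1 h2 h3⟩⟩
  · exact SAA.IsCenterThree.exists_presentation_of_isTypeC ⟨hd, hn, hi, hc, h3⟩ h5 hA
  · exact SAA.invariants_of_isomorphic hγ (SAA.const_ne_zero_of_irreducible hirr) hr hγ'
      (SAA.const_ne_zero_of_irreducible hirr') h
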